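/- **Setting.** A behaviour is a family $P(ab|xy)$, $a,b,x,y\in\{0,1\}$. It is local if $P(ab|xy)=\sum_\lambda p(\lambda)p(a|x\lambda)p(b|y\lambda)$ (finite sum of products of probability distributions), and quantum if $P(ab|xy)=\operatorname{tr}[\rho(A_x^a\otimes B_y^b)]$ for a density matrix $\rho$ on a tensor product of finite-dimensional Hilbert spaces and POVMs $A_x,B_y$; $\mathcal Q$ denotes the set of quantum behaviours. A post-selection game $G$ consists of an input distribution $\mu(x,y)$ and functions $S,V$ with values in $[0,1]$. Put $$\gamma_G(P)=\sum S\mu P,\qquad \omega_G(P)=\frac{\sum SV\mu P}{\gamma_G(P)},\qquad \omega_\ell(G)=\sup_{P\text{ local},\,\gamma_G(P)>0}\omega_G(P),$$ (sums over $a,b,x,y$) and define the statistical power $W_G(P)=\gamma_G(P)\,D(\omega_G(P)\,\|\,\omega_\ell(G))$, where $D(p\|q)=p\log_2\frac pq+(1-p)\log_2\frac{1-p}{1-q}$. Both games below have $\mu=1/4$. The CHSH game has $S=1$ and $V=1$ if $a\oplus b=xy$, $V=0$ otherwise. The Hardy game has $S=1$ on the events $(ab|xy)\in\{(00|00),(01|01),(10|10),(00|11)\}$,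 $S=0$ otherwise, and $V=1$ on $(00|00)$, $V=0$ otherwise. For detection efficiency $\eta$, with each party's lost photons recorded independently as outcome $1$, the effective behaviour is $E_\eta(P)(cd|xy)=\sum_{a,b}k_\eta(c|a)k_\eta(d|b)P(ab|xy)$, $k_\eta(c|a)=\eta\,\delta_{c,a}+(1-\eta)\,\delta_{c,1}$. Let $z(\eta)=3z_0(\eta-\tfrac23)$ with $z_0=\tfrac12(\sqrt5-1)$, $\alpha=\sqrt{z(\eta)}$, $\beta=\sqrt{1-z(\eta)}$, and let $Q_\eta(ab|xy)=|\langle A_x^aB_y^b|\psi\rangle|^2$ be Hardy's two-qubit behaviour, with $$|\psi\rangle=\frac{\alpha\beta(|01\rangle+|10\rangle)+\beta^2|11\rangle}{\sqrt{2\alpha^2\beta^2+\beta^4}},$$ $|A_0^0\rangle=|B_0^0\rangle=\beta|0\rangle-\alpha|1\rangle$, $|A_0^1\rangle=|B_0^1\rangle=\alpha|0\rangle+\beta|1\rangle$, $|A_1^a\rangle=|B_1^a\rangle=|a\rangle$. Put $$w_H(\eta)=W_{\rm Hardy}(E_\eta(Q_\eta)),\qquad w_C(\eta)=\sup\{W_{\rm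 CHSH}(E_\eta(Q)) : Q\in\mathcal Q,\ \omega_{\rm CHSH}(E_\eta(Q))\ge\omega_\ell({\rm CHSH})\},\qquad R_{\eta,Q_\eta}=\frac{w_H(\eta)}{w_C(\eta)} .$$ **Theorem.** 1. For every $\eta\in(2/3,1]$, $Q_\eta$ is a Hardy behaviour, that is, $Q_\eta\in\mathcal Q$ and $Q_\eta(01|01)=Q_\eta(10|10)=Q_\eta(00|11)=0<Q_\eta(00|00)$; moreover the set whose supremum is $w_C(\eta)$ is bounded above and $w_C(\eta)>0$. 2. As $\eta\to2/3^+$, $$\frac{w_H(\eta)}{(\eta-2/3)^4}\to\frac1{4!}\cdot\frac{2781-1215\sqrt5}{4\ln 2},\qquad w_C(\eta)=O\big((\eta-\tfrac23)^6\big).$$ 3. $\displaystyle\lim_{\eta\to2/3^+}R_{\eta,Q_\eta}=\infty$. -/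

import Mathlib

open Set Filter Topology Asymptotics
open scoped Kronecker ComplexOrder

noncomputable section

namespace PostSel

/-- A behaviour: `P a b x y` is the conditional probability `P(ab|xy)` of the outputs `a`, `b`
given the inputs `x`, `y`. -/
abbrev Behaviour (A B X Y : Type) := A → B → X → Y → ℝ

/-- A post-selection game: `μ x y` is the probability of the inputs, `S a b x y` the probability
that a round with event `(ab|xy)` is post-selected, `V a b x y` the probability that such a
round is won. A nonlocal game is the case `S = 1`. -/
structure PostSelectionGame (A B X Y : Type) [Fintype X] [Fintype Y] where
  S : A → B → X → Y → ℝ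
  V : A → B → X → Y → ℝ
  μ : X → Y → ℝ
  S_mem : ∀ a b x y, S a b x y ∈ Icc (0 : ℝ) 1
  V_mem : ∀ a b x y, V a b x y ∈ Icc (0 : ℝ) 1
  μ_nonneg : ∀ x y, 0 ≤ μ x y
  μ_sum : ∑ x, ∑ y, μ x y = 1

/-- `w` is a probability distribution on the finite type `O`. -/
def IsProb {O : Type} [Fintype O] (w : O → ℝ) : Prop :=
  (∀ o, 0 ≤ w o) ∧ ∑ o, w o = 1

/-- `M` is a POVM with outcomes in `O` on the Hilbert space `ℂ^d`. -/
def IsPOVM {O d : Type} [Fintype O] [Fintype d] [DecidableEq d] (M : O → Matrix d d ℂ) : Prop :=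
  (∀ o, (M o).PosSemidef) ∧ ∑ o, M o = 1

section Sets

variable (A B X Y : Type) [Fintype A] [Fintype B]

/-- The local behaviours `P(ab|xy) = ∑ l, p(l) pA(a|x,l) pB(b|y,l)`. -/
def localSet : Set (Behaviour A B X Y) :=
  {P | ∃ (n : ℕ) (p : Fin n → ℝ) (pA : Fin n → X → A → ℝ) (pB : Fin n → Y → B → ℝ),
    IsProb p ∧ (∀ l x, IsProb (pA l x)) ∧ (∀ l y, IsProb (pB l y)) ∧
    ∀ a b x y, P a b x y = ∑ l, p l * pA l x a * pB l y b}

/-- The quantum behaviours `P(ab|xy) = tr[ρ (M_x^a ⊗ N_y^b)]`, where `ρ` is a density matrix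
on a tensor product of two finite-dimensional Hilbert spaces and the `M_x`, `N_y` are POVMs. -/
def quantumSet : Set (Behaviour A B X Y) :=
  {P | ∃ (m n : ℕ) (ρ : Matrix (Fin m × Fin n) (Fin m × Fin n) ℂ)
      (M : X → A → Matrix (Fin m) (Fin m) ℂ) (N : Y → B → Matrix (Fin n) (Fin n) ℂ),
    ρ.PosSemidef ∧ ρ.trace = 1 ∧ (∀ x, IsPOVM (M x)) ∧ (∀ y, IsPOVM (N y)) ∧
    ∀ a b x y, (P a b x y : ℂ) = (ρ * (M x a ⊗ₖ N y b)).trace}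

end Sets

/-- The binary relative entropy `D(p‖q)`, with base-two logarithms. -/
def relEntropy (p q : ℝ) : ℝ :=
  p * Real.logb 2 (p / q) + (1 - p) * Real.logb 2 ((1 - p) / (1 - q))

namespace PostSelectionGame

variable {A B X Y : Type} [Fintype A] [Fintype B] [Fintype X] [Fintype Y]

/-- The probability `γ(P)` of post-selection. -/
def postProb (G : PostSelectionGame A B X Y) (P : Behaviour A B X Y) : ℝ :=
  ∑ a, ∑ b, ∑ x, ∑ y, G.S a b x y * G.μ x y * P a b x y

/-- The probability `ω(P)` of winning given post-selection; only meaningful if `γ(P) ≠ 0`. -/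
def winProb (G : PostSelectionGame A B X Y) (P : Behaviour A B X Y) : ℝ :=
  (∑ a, ∑ b, ∑ x, ∑ y, G.S a b x y * G.V a b x y * G.μ x y * P a b x y) / G.postProb P

/-- The local bound `ω_ℓ`. -/
def localBound (G : PostSelectionGame A B X Y) : ℝ :=
  sSup {w | ∃ P ∈ localSet A B X Y, 0 < G.postProb P ∧ w = G.winProb P}

/-- The statistical power `W_G(P) = γ(P) D(ω(P)‖ω_ℓ)`. -/
def power (G : PostSelectionGame A B X Y) (P : Behaviour A B X Y) : ℝ :=
  G.postProb P * relEntropy (G.winProb P) G.localBound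

end PostSelectionGame

/-- The CHSH game: uniform inputs, no post-selection, won iff `a ⊕ b = xy`
(arithmetic in `Fin 2` is modulo two). -/
def chsh : PostSelectionGame (Fin 2) (Fin 2) (Fin 2) (Fin 2) where
  S _ _ _ _ := 1
  V a b x y := if a + b = x * y then 1 else 0
  μ _ _ := 1 / 4
  S_mem _ _ _ _ := by simp
  V_mem a b x y := by split_ifs <;> simp
  μ_nonneg _ _ := by norm_num
  μ_sum := by norm_num [Fin.sum_univ_two]

/-- The Hardy game: uniform inputs, post-selection on the events
`(00|00), (01|01), (10|10), (00|11)`, won on `(00|00)`. -/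
def hardy : PostSelectionGame (Fin 2) (Fin 2) (Fin 2) (Fin 2) where
  S a b x y := if (a, b, x, y) = (0, 0, 0, 0) ∨ (a, b, x, y) = (0, 1, 0, 1) ∨
    (a, b, x, y) = (1, 0, 1, 0) ∨ (a, b, x, y) = (0, 0, 1, 1) then 1 else 0
  V a b x y := if (a, b, x, y) = (0, 0, 0, 0) then 1 else 0
  μ _ _ := 1 / 4
  S_mem a b x y := by split_ifs <;> simp
  V_mem a b x y := by split_ifs <;> simp
  μ_nonneg _ _ := by norm_num
  μ_sum := by norm_num [Fin.sum_univ_two]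

/-- The probability that a photon of ideal outcome `a` is recorded as outcome `c`, for detection
efficiency `η`: the photon is lost with probability `1 - η` and then recorded as outcome `1`. -/
def detect (η : ℝ) (a c : Fin 2) : ℝ :=
  η * (if c = a then 1 else 0) + (1 - η) * (if c = 1 then 1 else 0)

/-- The effective behaviour `E_η(P)` at detection efficiency `η`, both parties' photons being
lost independently. -/
def effective {X Y : Type} (η : ℝ) (P : Behaviour (Fin 2) (Fin 2) X Y) :
    Behaviour (Fin 2) (Fin 2) X Y :=
  fun c d x y => ∑ a, ∑ b, detect η a c * detect η b d * P a b x y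

theorem effective_zero_zero {X Y : Type} (η : ℝ) (P : Behaviour (Fin 2) (Fin 2) X Y)
    (x : X) (y : Y) : effective η P 0 0 x y = η ^ 2 * P 0 0 x y := by
  simp [effective, detect, pow_two]

theorem effective_zero_one {X Y : Type} (η : ℝ) (P : Behaviour (Fin 2) (Fin 2) X Y)
    (x : X) (y : Y) :
    effective η P 0 1 x y = η * P 0 1 x y + η * (1 - η) * P 0 0 x y := by
  simp [effective, detect]; ring

theorem effective_one_zero {X Y : Type} (η : ℝ) (P : Behaviour (Fin 2) (Fin 2) X Y)
    (x : X) (y : Y) :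
    effective η P 1 0 x y = η * P 1 0 x y + η * (1 - η) * P 0 0 x y := by
  simp [effective, detect]; ring

theorem effective_one_one {X Y : Type} (η : ℝ) (P : Behaviour (Fin 2) (Fin 2) X Y)
    (x : X) (y : Y) :
    effective η P 1 1 x y =
      P 1 1 x y + (1 - η) * (P 0 1 x y + P 1 0 x y) + (1 - η) ^ 2 * P 0 0 x y := by
  simp [effective, detect]; ring

/-- A Hardy behaviour: quantum, with `P(01|01) = P(10|10) = P(00|11) = 0 < P(00|00)`. -/
def IsHardyBehaviour (P : Behaviour (Fin 2) (Fin 2) (Fin 2) (Fin 2)) : Prop :=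
  P ∈ quantumSet (Fin 2) (Fin 2) (Fin 2) (Fin 2) ∧
    P 0 1 0 1 = 0 ∧ P 1 0 1 0 = 0 ∧ P 0 0 1 1 = 0 ∧ 0 < P 0 0 0 0

/-- The coordinates of `|ψ⟩ = N [αβ (|01⟩ + |10⟩) + β² |11⟩]`, `N = (2α²β² + β⁴)^(-1/2)`. -/
def hardyState (α β : ℝ) (i j : Fin 2) : ℝ :=
  (1 / √(2 * α ^ 2 * β ^ 2 + β ^ 4)) * !![0, α * β; α * β, β ^ 2] i j

/-- The coordinates of the measurement vectors of either party, for input `x` and output `a`: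
`β|0⟩ - α|1⟩` and `α|0⟩ + β|1⟩` for `x = 0`, and `|0⟩` and `|1⟩` for `x = 1`. -/
def hardyVec (α β : ℝ) (x a : Fin 2) : Fin 2 → ℝ :=
  if x = 0 then (if a = 0 then ![β, -α] else ![α, β]) else (if a = 0 then ![1, 0] else ![0, 1])

/-- Hardy's two-qubit behaviour `|⟨A_x^a B_y^b|ψ⟩|²` (all the vectors are real). -/
def hardyBehaviour (α β : ℝ) : Behaviour (Fin 2) (Fin 2) (Fin 2) (Fin 2) :=
  fun a b x y => (∑ i, ∑ j, hardyVec α β x a i * hardyVec α β y b j * hardyState α β i j) ^ 2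

/-- `z(η) = 3 z₀ (η - 2/3)` with `z₀ = (√5 - 1)/2`. -/
def zParam (η : ℝ) : ℝ := 3 * ((√5 - 1) / 2) * (η - 2 / 3)

/-- The family `Q_η`: Hardy's behaviour with `α² = z(η)` and `α² + β² = 1`. -/
def hardyFamily (η : ℝ) : Behaviour (Fin 2) (Fin 2) (Fin 2) (Fin 2) :=
  hardyBehaviour (√(zParam η)) (√(1 - zParam η))

/-- The values `W_CHSH(E_η(Q))` of the CHSH power at efficiency `η`, over all the quantum
behaviours `Q` for which the test is meaningful: the winning probability is at least the local
bound. -/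
def chshPowers (η : ℝ) : Set ℝ :=
  {w | ∃ Q ∈ quantumSet (Fin 2) (Fin 2) (Fin 2) (Fin 2),
    chsh.localBound ≤ chsh.winProb (effective η Q) ∧ w = chsh.power (effective η Q)}

/-- The optimal CHSH power at efficiency `η`. -/
def optChshPower (η : ℝ) : ℝ := sSup (chshPowers η)

/-- The ratio of the Hardy power of `Q` to the optimal CHSH power, at efficiency `η`. -/
def powerRatio (η : ℝ) (Q : Behaviour (Fin 2) (Fin 2) (Fin 2) (Fin 2)) : ℝ :=
  hardy.power (effective η Q) / optChshPower η

end PostSel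

end

namespace PostSel

/-! ### Binary relative entropy -/

/-! Write `η = 2/3 + t`. Near the threshold both tests have a winning probability barely above their
local bound, and relative entropy is quadratic in that excess. The claim is a comparison of orders
in `t`.

Hardy test: with `z = O(t)` the post-selected mass is of order `t ^ 2`, but the conditional winning
probability exceeds `1/2` by order `t`, since the small factor `z ^ 2 / (1 + z)` cancels in the
quotient. Hence the power has order `t ^ 4`; `tendsto_relEntropy_half` supplies the exact constant.

CHSH test: no post-selection hides the small mass. The excess over `3/4` is `η / 2` times a
Clauser–Horne expression, which is `O(t ^ 3)` for every quantum behaviour; the chi-squared bound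
`relEntropy_le` then gives `O(t ^ 6)`.

The core is this cubic bound. For projections the expression is `3t n²` minus nonnegative error
terms, with `n = ‖A₀B₀ψ‖`. If it is positive, all errors are `O(t n²)`, so the behaviour is nearly
Hardy's. Splitting `ψ` into joint eigenvectors of `(A₀ - A₁)²` and `(B₀ - B₁)²` (a form of Jordan's
lemma) makes certain norms multiplicative, as for product vectors. A quantitative Hardy argument
then forces `n = O(t) ‖ψ‖`, so `3t n² = O(t ^ 3) ‖ψ‖²` (`ch_le_of_joint_eigenvector`,
`ch_real_bound`). POVMs reduce to projections because the expression is linear in each effect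
(`exists_projection_le`). -/

theorem relEntropy_eq (p q : ℝ) : relEntropy p q =
    (p * Real.log (p / q) + (1 - p) * Real.log ((1 - p) / (1 - q))) / Real.log 2 := by
  rw [relEntropy, Real.logb, Real.logb]; ring

theorem mul_log_div_le {p q : ℝ} (hp : 0 ≤ p) (hq : 0 < q) :
    p * Real.log (p / q) ≤ p * (p / q - 1) := by
  rcases hp.eq_or_lt with rfl | hp
  · simp
  · exact mul_le_mul_of_nonneg_left (Real.log_le_sub_one_of_pos (by positivity)) hp.le

theorem sub_le_mul_log_div {p q : ℝ} (hp : 0 ≤ p) (hq : 0 < q) :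
    p - q ≤ p * Real.log (p / q) := by
  rcases hp.eq_or_lt with rfl | hp
  · simpa using hq.le
  · have := Real.log_le_sub_one_of_pos (show 0 < q / p by positivity)
    rw [← neg_neg (Real.log (p / q)), ← Real.log_inv, inv_div]
    have h2 : p * Real.log (q / p) ≤ p * (q / p - 1) := by gcongr
    have h3 : p * (q / p - 1) = q - p := by field_simp
    linarith

theorem sub_lt_mul_log_div {p q : ℝ} (hp : 0 < p) (hq : 0 < q) (hpq : p ≠ q) :
    p - q < p * Real.log (p / q) := by
  have := Real.log_lt_sub_one_of_pos (show 0 < q / p by positivity)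
    (by rw [ne_eq, div_eq_one_iff_eq hp.ne']; exact hpq.symm)
  rw [← neg_neg (Real.log (p / q)), ← Real.log_inv, inv_div]
  have h2 : p * Real.log (q / p) < p * (q / p - 1) := by gcongr
  have h3 : p * (q / p - 1) = q - p := by field_simp
  linarith

/-- The relative entropy is at most the chi-squared divergence, up to the change of base. -/
theorem relEntropy_le {p q : ℝ} (hp : p ∈ Icc (0 : ℝ) 1) (hq : q ∈ Ioo (0 : ℝ) 1) :
    relEntropy p q ≤ (p - q) ^ 2 / (q * (1 - q)) / Real.log 2 := by
  have hl := Real.log_pos one_lt_two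
  have hq1 := hq.1
  have hq2 : 0 < 1 - q := by linarith [hq.2]
  rw [relEntropy_eq]
  gcongr
  have h1 := mul_log_div_le hp.1 hq1
  have h2 := mul_log_div_le (sub_nonneg.2 hp.2) hq2
  have h3 : (p - q) ^ 2 / (q * (1 - q)) =
      p * (p / q - 1) + (1 - p) * ((1 - p) / (1 - q) - 1) := by
    field_simp; ring
  linarith

/-- The bounds `p - q` and `q - p` for the two summands cancel, and the first is strict because `p >
0`. The value `p = 1` is allowed. -/
theorem relEntropy_pos {p q : ℝ} (hp : p ∈ Ioc (0 : ℝ) 1) (hq : q ∈ Ioo (0 : ℝ) 1) (h : p ≠ q) :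
    0 < relEntropy p q := by
  rw [relEntropy_eq]
  have h1 := sub_lt_mul_log_div hp.1 hq.1 h
  have h2 := sub_le_mul_log_div (sub_nonneg.2 hp.2) (sub_pos.2 hq.2)
  exact div_pos (by linarith) (Real.log_pos one_lt_two)

theorem abs_log_one_sub_add_le {x : ℝ} (hx : |x| ≤ 1 / 2) :
    |x + x ^ 2 / 2 + Real.log (1 - x)| ≤ 2 * |x| ^ 3 := by
  have h := Real.abs_log_sub_add_sum_range_le (show |x| < 1 by linarith) 2
  norm_num [Finset.sum_range_succ] at h
  refine h.trans ?_
  rw [div_le_iff₀ (by linarith)]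
  nlinarith [pow_nonneg (abs_nonneg x) 3]

/-- Second-order expansions of `log (1 ± 2δ)`, weighted by `1/2 ± δ`, add up to exactly `2δ²`. The
weights sum to one, so the remainder is at most `2 (2|δ|)³`; the constant `24` leaves room. -/
theorem abs_relEntropy_half_sub_le {δ : ℝ} (hδ : |δ| ≤ 1 / 4) :
    |relEntropy (1 / 2 + δ) (1 / 2) - 2 / Real.log 2 * δ ^ 2| ≤ 24 / Real.log 2 * |δ| ^ 3 := by
  have hl := Real.log_pos one_lt_two
  have e : relEntropy (1 / 2 + δ) (1 / 2) - 2 / Real.log 2 * δ ^ 2 =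
      ((1 / 2 + δ) * (-(2 * δ) + (-(2 * δ)) ^ 2 / 2 + Real.log (1 - -(2 * δ))) +
        (1 / 2 - δ) * (2 * δ + (2 * δ) ^ 2 / 2 + Real.log (1 - 2 * δ))) / Real.log 2 := by
    rw [relEntropy_eq, show (1 / 2 + δ) / (1 / 2) = 1 - -(2 * δ) by ring,
      show (1 - (1 / 2 + δ)) / (1 - 1 / 2) = 1 - 2 * δ by ring]
    field_simp
    ring
  have h2 : |2 * δ| = 2 * |δ| := by rw [abs_mul]; norm_num
  have k1 := abs_log_one_sub_add_le (x := 2 * δ) (by rw [h2]; linarith)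
  have k2 := abs_log_one_sub_add_le (x := -(2 * δ)) (by rw [abs_neg, h2]; linarith)
  rw [abs_neg] at k2
  rw [h2] at k1 k2
  obtain ⟨l1, l2⟩ := abs_le.1 hδ
  rw [e, abs_div, abs_of_pos hl, div_mul_eq_mul_div]
  gcongr
  refine (abs_add_le _ _).trans ?_
  rw [abs_mul, abs_mul, abs_of_nonneg (show 0 ≤ 1 / 2 + δ by linarith),
    abs_of_nonneg (show 0 ≤ 1 / 2 - δ by linarith)]
  have m1 := mul_le_mul_of_nonneg_left k2 (show 0 ≤ 1 / 2 + δ by linarith)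
  have m2 := mul_le_mul_of_nonneg_left k1 (show 0 ≤ 1 / 2 - δ by linarith)
  nlinarith [pow_nonneg (abs_nonneg δ) 3]

theorem tendsto_relEntropy_half :
    Tendsto (fun δ : ℝ => relEntropy (1 / 2 + δ) (1 / 2) / δ ^ 2) (𝓝[≠] 0)
      (𝓝 (2 / Real.log 2)) := by
  rw [tendsto_iff_norm_sub_tendsto_zero]
  have hlim : Tendsto (fun δ : ℝ => 24 / Real.log 2 * |δ|) (𝓝[≠] 0) (𝓝 0) := by
    have : Continuous fun δ : ℝ => 24 / Real.log 2 * |δ| := by fun_prop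
    simpa using (this.tendsto 0).mono_left nhdsWithin_le_nhds
  refine squeeze_zero' (Eventually.of_forall fun _ => norm_nonneg _) ?_ hlim
  have hsmall : ∀ᶠ δ : ℝ in 𝓝[≠] 0, |δ| ≤ 1 / 4 := by
    refine eventually_nhdsWithin_of_eventually_nhds ?_
    filter_upwards [Metric.closedBall_mem_nhds (0 : ℝ) (show (0 : ℝ) < 1 / 4 by norm_num)] with x hx
    simpa using hx
  filter_upwards [hsmall, self_mem_nhdsWithin] with δ hδ h0
  have h0' : δ ≠ 0 := h0
  have h := abs_relEntropy_half_sub_le hδ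
  rw [Real.norm_eq_abs, show relEntropy (1 / 2 + δ) (1 / 2) / δ ^ 2 - 2 / Real.log 2 =
    (relEntropy (1 / 2 + δ) (1 / 2) - 2 / Real.log 2 * δ ^ 2) / δ ^ 2 by field_simp, abs_div,
    div_le_iff₀ (by positivity), abs_of_nonneg (sq_nonneg δ)]
  refine h.trans (le_of_eq ?_)
  rw [← sq_abs δ]; ring

/-! ### Local bounds -/

/-- The Clauser--Horne inequality for products of probabilities. -/
theorem ch_product_le {a₀ a₁ b₀ b₁ : ℝ} (ha₀ : a₀ ∈ Icc (0 : ℝ) 1) (ha₁ : a₁ ∈ Icc (0 : ℝ) 1)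
    (hb₀ : b₀ ∈ Icc (0 : ℝ) 1) (hb₁ : b₁ ∈ Icc (0 : ℝ) 1) :
    a₀ * b₀ ≤ a₀ * (1 - b₁) + (1 - a₁) * b₀ + a₁ * b₁ := by
  obtain ⟨p0, q0⟩ := ha₀
  obtain ⟨p1, q1⟩ := ha₁
  obtain ⟨r0, s0⟩ := hb₀
  obtain ⟨r1, s1⟩ := hb₁
  -- The difference of the two sides is exactly the sum of the four nonnegative products below.
  have h1 : 0 ≤ a₀ * (1 - b₀) * (1 - b₁) :=
    mul_nonneg (mul_nonneg p0 (sub_nonneg.2 s0)) (sub_nonneg.2 s1)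
  have h2 : 0 ≤ (1 - a₀) * b₀ * (1 - a₁) :=
    mul_nonneg (mul_nonneg (sub_nonneg.2 q0) r0) (sub_nonneg.2 q1)
  have h3 : 0 ≤ a₁ * b₁ * (1 - a₀ * b₀) :=
    mul_nonneg (mul_nonneg p1 r1) (by nlinarith)
  have h4 : 0 ≤ a₀ * b₀ * ((1 - a₁) * (1 - b₁)) :=
    mul_nonneg (mul_nonneg p0 r0) (mul_nonneg (sub_nonneg.2 q1) (sub_nonneg.2 s1))
  linarith

theorem IsProb.le_one {O : Type} [Fintype O] {w : O → ℝ} (h : IsProb w) (o : O) : w o ≤ 1 := by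
  rw [← h.2]
  exact Finset.single_le_sum (fun i _ => h.1 i) (Finset.mem_univ o)

theorem IsProb.fin_two {w : Fin 2 → ℝ} (h : IsProb w) : w 1 = 1 - w 0 := by
  have := h.2
  rw [Fin.sum_univ_two] at this
  linarith

theorem localSet_ch_le {P : Behaviour (Fin 2) (Fin 2) (Fin 2) (Fin 2)}
    (hP : P ∈ localSet (Fin 2) (Fin 2) (Fin 2) (Fin 2)) :
    P 0 0 0 0 ≤ P 0 1 0 1 + P 1 0 1 0 + P 0 0 1 1 := by
  obtain ⟨n, p, pA, pB, hp, hA, hB, h⟩ := hP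
  simp only [h, ← Finset.sum_add_distrib]
  refine Finset.sum_le_sum fun l _ => ?_
  have := ch_product_le ⟨(hA l 0).1 0, (hA l 0).le_one 0⟩ ⟨(hA l 1).1 0, (hA l 1).le_one 0⟩
    ⟨(hB l 0).1 0, (hB l 0).le_one 0⟩ ⟨(hB l 1).1 0, (hB l 1).le_one 0⟩
  rw [(hA l 1).fin_two, (hB l 1).fin_two]
  have h2 := mul_le_mul_of_nonneg_left this (hp.1 l)
  linarith

theorem hardy_postProb (P : Behaviour (Fin 2) (Fin 2) (Fin 2) (Fin 2)) :
    hardy.postProb P = (P 0 0 0 0 + P 0 1 0 1 + P 1 0 1 0 + P 0 0 1 1) / 4 := by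
  simp [PostSelectionGame.postProb, hardy, Fin.sum_univ_two]; ring

theorem hardy_winProb (P : Behaviour (Fin 2) (Fin 2) (Fin 2) (Fin 2)) :
    hardy.winProb P = P 0 0 0 0 / (P 0 0 0 0 + P 0 1 0 1 + P 1 0 1 0 + P 0 0 1 1) := by
  rw [PostSelectionGame.winProb, hardy_postProb]
  simp [hardy, Fin.sum_univ_two]
  rw [inv_mul_eq_div, div_div_div_cancel_right₀ (by norm_num)]

theorem chsh_postProb (P : Behaviour (Fin 2) (Fin 2) (Fin 2) (Fin 2)) :
    chsh.postProb P = (∑ x, ∑ y, ∑ a, ∑ b, P a b x y) / 4 := by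
  simp [PostSelectionGame.postProb, chsh, Fin.sum_univ_two]; ring

theorem chsh_winProb (P : Behaviour (Fin 2) (Fin 2) (Fin 2) (Fin 2)) :
    chsh.winProb P = (P 0 0 0 0 + P 1 1 0 0 + P 0 0 0 1 + P 1 1 0 1 + P 0 0 1 0 + P 1 1 1 0 +
      P 0 1 1 1 + P 1 0 1 1) / 4 / chsh.postProb P := by
  rw [PostSelectionGame.winProb]
  congr 1
  simp [chsh, Fin.sum_univ_two]; ring

/-- A normalized behaviour whose marginals `α`, `β` do not depend on the other party's input. -/
theorem chsh_winProb_of_noSignalling {P : Behaviour (Fin 2) (Fin 2) (Fin 2) (Fin 2)}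
    {α β : Fin 2 → ℝ} (hsum : ∀ x y, ∑ a, ∑ b, P a b x y = 1)
    (hα : ∀ x y, P 0 0 x y + P 0 1 x y = α x) (hβ : ∀ x y, P 0 0 x y + P 1 0 x y = β y) :
    chsh.postProb P = 1 ∧ chsh.winProb P =
      3 / 4 + 1 / 2 * (P 0 0 0 0 - P 0 1 0 1 - P 1 0 1 0 - P 0 0 1 1) := by
  have h1 : chsh.postProb P = 1 := by
    rw [chsh_postProb]; simp only [hsum]; norm_num
  refine ⟨h1, ?_⟩
  rw [chsh_winProb, h1]
  simp only [Fin.sum_univ_two] at hsum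
  linarith [hsum 0 0, hsum 0 1, hsum 1 0, hsum 1 1, hα 0 0, hα 0 1, hα 1 0, hα 1 1,
    hβ 0 0, hβ 0 1, hβ 1 0, hβ 1 1]

theorem chsh_winProb_of_localSet {P : Behaviour (Fin 2) (Fin 2) (Fin 2) (Fin 2)}
    (hP : P ∈ localSet (Fin 2) (Fin 2) (Fin 2) (Fin 2)) :
    chsh.postProb P = 1 ∧ chsh.winProb P =
      3 / 4 + 1 / 2 * (P 0 0 0 0 - P 0 1 0 1 - P 1 0 1 0 - P 0 0 1 1) := by
  obtain ⟨n, p, pA, pB, hp, hA, hB, h⟩ := hP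
  refine chsh_winProb_of_noSignalling (α := fun x => ∑ l, p l * pA l x 0)
    (β := fun y => ∑ l, p l * pB l y 0) (fun x y => ?_) (fun x y => ?_) (fun x y => ?_)
  · simp only [Fin.sum_univ_two, h, ← Finset.sum_add_distrib, (hA _ x).fin_two, (hB _ y).fin_two]
    conv_rhs => rw [← hp.2]
    exact Finset.sum_congr rfl fun l _ => by ring
  · simp only [h, ← Finset.sum_add_distrib, (hB _ y).fin_two]
    exact Finset.sum_congr rfl fun l _ => by ring
  · simp only [h, ← Finset.sum_add_distrib, (hA _ x).fin_two]
    exact Finset.sum_congr rfl fun l _ => by ring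

/-- The deterministic behaviour with constant outputs `0`. -/
def zeroBehaviour : Behaviour (Fin 2) (Fin 2) (Fin 2) (Fin 2) :=
  fun a b _ _ => if a = 0 ∧ b = 0 then 1 else 0

theorem zeroBehaviour_mem_localSet : zeroBehaviour ∈ localSet (Fin 2) (Fin 2) (Fin 2) (Fin 2) := by
  have h : IsProb fun a : Fin 2 => if a = 0 then (1 : ℝ) else 0 :=
    ⟨fun a => by dsimp only; split_ifs <;> norm_num, by simp⟩
  refine ⟨1, fun _ => 1, fun _ _ a => if a = 0 then 1 else 0, fun _ _ b => if b = 0 then 1 else 0,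
    ⟨fun _ => by norm_num, by simp⟩, fun _ _ => h, fun _ _ => h, fun a b x y => ?_⟩
  fin_cases a <;> fin_cases b <;> simp [zeroBehaviour]

/-- The Clauser–Horne inequality says that the winning event weighs at most as much as the three
losing post-selected events together. Always answering `0` gives equality. -/
theorem localBound_hardy : hardy.localBound = 1 / 2 := by
  refine IsGreatest.csSup_eq ⟨⟨zeroBehaviour, zeroBehaviour_mem_localSet, ?_, ?_⟩, ?_⟩
  · rw [hardy_postProb]; norm_num [zeroBehaviour]
  · rw [hardy_winProb]; norm_num [zeroBehaviour]
  · rintro w ⟨P, hP, hpos, rfl⟩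
    rw [hardy_postProb] at hpos
    rw [hardy_winProb, div_le_iff₀ (by linarith)]
    linarith [localSet_ch_le hP]

theorem localBound_chsh : chsh.localBound = 3 / 4 := by
  obtain ⟨h1, h2⟩ := chsh_winProb_of_localSet zeroBehaviour_mem_localSet
  refine IsGreatest.csSup_eq ⟨⟨zeroBehaviour, zeroBehaviour_mem_localSet, ?_, ?_⟩, ?_⟩
  · rw [h1]; norm_num
  · rw [h2]; norm_num [zeroBehaviour]
  · rintro w ⟨P, hP, hpos, rfl⟩
    rw [(chsh_winProb_of_localSet hP).2]
    linarith [localSet_ch_le hP]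

end PostSel

namespace PostSel

/-! ### Cubic Clauser–Horne bound for commuting pairs of projections -/

section Operators

variable {E : Type*} [NormedAddCommGroup E] [InnerProductSpace ℂ E]

/-- A vector is an orthogonal sum of joint eigenvectors of two commuting symmetric operators. -/
theorem exists_joint_eigenvector_decomposition [FiniteDimensional ℂ E] {S T : Module.End ℂ E}
    (hS : LinearMap.IsSymmetric S) (hT : LinearMap.IsSymmetric T) (hST : Commute S T) (ψ : E) :
    ∃ (s : Finset (ℂ × ℂ)) (v : ℂ × ℂ → E),
      (∀ k, S (v k) = k.2 • v k ∧ T (v k) = k.1 • v k) ∧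
      ∀ X : Module.End ℂ E, Commute X S → Commute X T →
        ‖X ψ‖ ^ 2 = ∑ k ∈ s, ‖X (v k)‖ ^ 2 := by
  have htop := LinearMap.IsSymmetric.iSup_iSup_eigenspace_inf_eigenspace_eq_top_of_commute hS hT hST
  have hfam := LinearMap.IsSymmetric.orthogonalFamily_eigenspace_inf_eigenspace hS hT
  have hψ : ψ ∈ ⨆ i : ℂ × ℂ, (Module.End.eigenspace S i.2 ⊓ Module.End.eigenspace T i.1) := by
    rw [iSup_prod, iSup_comm, htop]; trivial
  obtain ⟨f, hf, hsum⟩ := (Submodule.mem_iSup_iff_exists_finsupp _ _).1 hψ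
  refine ⟨f.support, f, fun k => ?_, fun X hXS hXT => ?_⟩
  · have h := hf k
    rw [Submodule.mem_inf, Module.End.mem_eigenspace_iff, Module.End.mem_eigenspace_iff] at h
    exact h
  · have hmem : ∀ k, X (f k) ∈ Module.End.eigenspace S k.2 ⊓ Module.End.eigenspace T k.1 := by
      intro k
      have h := hf k
      rw [Submodule.mem_inf, Module.End.mem_eigenspace_iff, Module.End.mem_eigenspace_iff] at h ⊢
      have h1 : S (X (f k)) = X (S (f k)) := (LinearMap.congr_fun hXS (f k)).symm
      have h2 : T (X (f k)) = X (T (f k)) := (LinearMap.congr_fun hXT (f k)).symm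
      rw [h1, h2, h.1, h.2, map_smul, map_smul]
      exact ⟨rfl, rfl⟩
    have := hfam.norm_sum (fun k => ⟨X (f k), hmem k⟩) f.support
    rw [← hsum, Finsupp.sum, map_sum]
    simpa using this

theorem inner_projection_left {P : Module.End ℂ E} (hs : LinearMap.IsSymmetric P)
    (h : P * P = P) (x y : E) : inner ℂ (P x) y = inner ℂ (P x) (P y) := by
  rw [← hs (P x) y, ← Module.End.mul_apply, h]

theorem norm_projection_le {P : Module.End ℂ E} (hs : LinearMap.IsSymmetric P)
    (h : P * P = P) (x : E) : ‖P x‖ ≤ ‖x‖ := by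
  have h1 : (‖P x‖ : ℝ) ^ 2 = ‖inner ℂ (P x) x‖ := by
    rw [inner_projection_left hs h, inner_self_eq_norm_sq_to_K]; simp
  have h2 := norm_inner_le_norm (𝕜 := ℂ) (P x) x
  rw [← h1] at h2
  rcases (norm_nonneg (P x)).eq_or_lt with h0 | h0
  · rw [← h0]; positivity
  · nlinarith

theorem isSymmetric_one_sub {P : Module.End ℂ E} (hs : LinearMap.IsSymmetric P) :
    LinearMap.IsSymmetric (1 - P) :=
  LinearMap.IsSymmetric.sub LinearMap.IsSymmetric.id hs

theorem one_sub_mul_self {R : Type*} [Ring R] {P : R} (h : P * P = P) :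
    (1 - P) * (1 - P) = 1 - P := by
  noncomm_ring; rw [h]; abel

/-- For projections `P`, `Q`, the square of `P - Q` compressed to the range of `P`. -/
theorem mul_one_sub_mul_eq {R : Type*} [Ring R] {P Q : R} (hP : P * P = P) (hQ : Q * Q = Q) :
    P * ((1 - Q) * P) = (P - Q) * (P - Q) * P := by
  have e1 : (P - Q) * (P - Q) * P = P * P * P - P * Q * P - Q * (P * P) + Q * Q * P := by
    noncomm_ring
  have e2 : P * ((1 - Q) * P) = P * P - P * Q * P := by noncomm_ring
  rw [e1, e2, hP, hP, hQ]; abel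

theorem commute_sub_mul_sub {R : Type*} [Ring R] {P Q : R} (hP : P * P = P) (hQ : Q * Q = Q) :
    Commute P ((P - Q) * (P - Q)) := by
  have e1 : P * ((P - Q) * (P - Q)) = P * P * P - P * P * Q - P * Q * P + P * (Q * Q) := by
    noncomm_ring
  have e2 : (P - Q) * (P - Q) * P = P * P * P - P * Q * P - Q * (P * P) + Q * Q * P := by
    noncomm_ring
  rw [Commute, SemiconjBy, e1, e2, hP, hP, hQ]; abel

theorem isSymmetric_mul {P Q : Module.End ℂ E} (hP : LinearMap.IsSymmetric P)
    (hQ : LinearMap.IsSymmetric Q) (h : Commute P Q) : LinearMap.IsSymmetric (P * Q) := by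
  intro x y
  conv_rhs => rw [h.eq]
  rw [Module.End.mul_apply, Module.End.mul_apply, hP, hQ]

theorem mul_mul_mul_self {R : Type*} [Ring R] {P Q : R} (hP : P * P = P) (hQ : Q * Q = Q)
    (h : Commute P Q) : (P * Q) * (P * Q) = P * Q := by
  rw [h.symm.mul_mul_mul_comm, hP, hQ]

/-- The norm of `P φ` when `φ` is fixed by `R` and an eigenvector of the compression `R P R`. -/
theorem norm_sq_projection_eq {P R : Module.End ℂ E} (sP : LinearMap.IsSymmetric P)
    (iP : P * P = P) (sR : LinearMap.IsSymmetric R) {φ : E} {c : ℂ} (hR : R φ = φ)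
    (hc : R (P φ) = c • φ) : ((‖P φ‖ : ℝ) : ℂ) ^ 2 = c * ((‖φ‖ : ℝ) : ℂ) ^ 2 := by
  have h := inner_self_eq_norm_sq_to_K (𝕜 := ℂ) (P φ)
  rw [sP, ← Module.End.mul_apply, iP] at h
  have h2 : inner ℂ φ (P φ) = c * inner ℂ φ φ := by
    rw [← inner_smul_right, ← hc, ← sR, hR]
  rw [h2, inner_self_eq_norm_sq_to_K] at h
  exact h.symm

/-- Sharpens Cauchy–Schwarz by moving `R` onto `x`: only the part of `x` seen by `R` counts, which
is what the error terms measure. -/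
theorem norm_inner_le_of_fixed {R : Module.End ℂ E} (sR : LinearMap.IsSymmetric R) {φ : E}
    (hR : R φ = φ) (x : E) : ‖inner ℂ φ x‖ ≤ ‖φ‖ * ‖R x‖ := by
  have : inner ℂ φ x = inner ℂ φ (R x) := by rw [← sR, hR]
  rw [this]
  exact norm_inner_le_norm _ _

/-- The real inequality behind `ch_le_of_joint_eigenvector`. -/
theorem ch_real_bound {t n x₁ x₂ x₃ g₁ g₂ α β y N : ℝ} (ht : 0 < t) (ht' : t ≤ 1 / 144)
    (hn : 0 ≤ n) (hx₁ : 0 ≤ x₁) (hx₂ : 0 ≤ x₂) (hx₃ : 0 ≤ x₃) (hα : 0 ≤ α)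
    (hβ : 0 ≤ β) (hN : 0 ≤ N) (h : n ^ 2 ≤ n * (x₁ + x₂ + x₃) + y * N)
    (hyn : y * n = α * β) (hα' : α ≤ x₂ + g₂) (hβ' : β ≤ x₁ + g₁) :
    3 * t * n ^ 2 - (2 / 3 + t) * (x₁ ^ 2 + x₂ ^ 2 + x₃ ^ 2) - (1 / 3 - t) * (g₁ ^ 2 + g₂ ^ 2) ≤
      1728 * t ^ 3 * N ^ 2 := by
  by_contra! hcon
  -- For `t ≤ 1/144` both error coefficients are at least `1/4`, so the negated claim bounds the
  -- total error `ε` by `12 t n²`.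
  have hRHS : 0 ≤ 1728 * t ^ 3 * N ^ 2 := by positivity
  set ε := x₁ ^ 2 + x₂ ^ 2 + x₃ ^ 2 + g₁ ^ 2 + g₂ ^ 2 with hε
  have hpos : 1728 * t ^ 3 * N ^ 2 < 3 * t * n ^ 2 - 1 / 4 * ε := by
    have h1 : 0 ≤ (2 / 3 + t - 1 / 4) * (x₁ ^ 2 + x₂ ^ 2 + x₃ ^ 2) :=
      mul_nonneg (by linarith) (by positivity)
    have h2 : 0 ≤ (1 / 3 - t - 1 / 4) * (g₁ ^ 2 + g₂ ^ 2) :=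
      mul_nonneg (by linarith) (by positivity)
    rw [hε]; linarith
  have hεn : ε ≤ 12 * t * n ^ 2 := by linarith
  have hn0 : 0 < n := by
    rcases hn.eq_or_lt with h0 | h0
    · rw [← h0] at hpos
      have : 0 ≤ ε := by positivity
      linarith
    · exact h0
  -- By Cauchy–Schwarz the square is at most `3ε ≤ 36 t n²`; the threshold `1/144` makes this `n² /
  -- 4`.
  have hx : x₁ + x₂ + x₃ ≤ n / 2 := by
    refine (sq_le_sq₀ (by positivity) (by positivity)).1 ?_
    have : (x₁ + x₂ + x₃) ^ 2 ≤ 3 * (x₁ ^ 2 + x₂ ^ 2 + x₃ ^ 2) := by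
      nlinarith [sq_nonneg (x₁ - x₂), sq_nonneg (x₁ - x₃), sq_nonneg (x₂ - x₃)]
    have h2 : t * n ^ 2 ≤ 1 / 144 * n ^ 2 := by gcongr
    linarith [sq_nonneg g₁, sq_nonneg g₂]
  have hαβ : α * β ≤ 12 * t * n ^ 2 := by
    have h1 : α * β ≤ (x₂ + g₂) * (x₁ + g₁) := mul_le_mul hα' hβ' hβ (hα.trans hα')
    linarith [sq_nonneg (x₂ - g₂), sq_nonneg (x₁ - g₁), sq_nonneg (x₂ + g₂ - (x₁ + g₁)),
      sq_nonneg x₃]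
  have hy' : y ≤ 12 * t * n := by
    rw [← hyn] at hαβ
    exact le_of_mul_le_mul_right (by linarith) hn0
  -- Half of `n²` is absorbed, leaving `n² / 2 ≤ 12 t n N`. Then `3t (24 t N)² = 1728 t³ N²`
  -- contradicts the assumption.
  have hfin : n ≤ 24 * t * N := by
    have h1 : n * (x₁ + x₂ + x₃) ≤ n * (n / 2) := by gcongr
    have h2 : y * N ≤ 12 * t * n * N := by gcongr
    exact le_of_mul_le_mul_left (by linarith) hn0
  have h3 : n ^ 2 ≤ (24 * t * N) ^ 2 := by gcongr
  have h4 : 3 * t * n ^ 2 ≤ 3 * t * (24 * t * N) ^ 2 := by gcongr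
  have h5 : 0 ≤ ε := by positivity
  linarith

/-- The Clauser--Horne expression at efficiency `2/3 + t`, for two pairs of commuting projections,
on a joint eigenvector of the squares of the differences in each pair. -/
theorem ch_le_of_joint_eigenvector {A₀ A₁ B₀ B₁ : Module.End ℂ E}
    (sA₀ : LinearMap.IsSymmetric A₀) (sA₁ : LinearMap.IsSymmetric A₁)
    (sB₀ : LinearMap.IsSymmetric B₀) (sB₁ : LinearMap.IsSymmetric B₁)
    (iA₀ : A₀ * A₀ = A₀) (iA₁ : A₁ * A₁ = A₁) (iB₀ : B₀ * B₀ = B₀) (iB₁ : B₁ * B₁ = B₁)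
    (c₀₀ : Commute A₀ B₀) (c₀₁ : Commute A₀ B₁) (c₁₀ : Commute A₁ B₀) (c₁₁ : Commute A₁ B₁)
    {ψ : E} {a b : ℂ} (ha : ((A₀ - A₁) * (A₀ - A₁)) ψ = a • ψ)
    (hb : ((B₀ - B₁) * (B₀ - B₁)) ψ = b • ψ) {t : ℝ} (ht : 0 < t) (ht' : t ≤ 1 / 144) :
    3 * t * ‖(A₀ * B₀) ψ‖ ^ 2 - (2 / 3 + t) * (‖(A₀ * (1 - B₁)) ψ‖ ^ 2 +
      ‖((1 - A₁) * B₀) ψ‖ ^ 2 + ‖(A₁ * B₁) ψ‖ ^ 2) -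
      (1 / 3 - t) * (‖(A₀ * (1 - B₀)) ψ‖ ^ 2 + ‖((1 - A₀) * B₀) ψ‖ ^ 2) ≤
      1728 * t ^ 3 * ‖ψ‖ ^ 2 := by
  set φ := (A₀ * B₀) ψ with hφ
  have sA₁' := isSymmetric_one_sub sA₁
  have sB₁' := isSymmetric_one_sub sB₁
  have iA₁' := one_sub_mul_self iA₁
  have iB₁' := one_sub_mul_self iB₁
  have hAφ : A₀ φ = φ := by
    rw [hφ, ← Module.End.mul_apply, ← mul_assoc, iA₀]
  have hBφ : B₀ φ = φ := by
    rw [hφ, ← Module.End.mul_apply, ← mul_assoc, ← c₀₀.eq, mul_assoc, iB₀]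
  have cB0A : Commute B₀ (A₀ - A₁) := c₀₀.symm.sub_right c₁₀.symm
  have cA0B : Commute A₀ (B₀ - B₁) := c₀₀.sub_right c₀₁
  have haφ : ((A₀ - A₁) * (A₀ - A₁)) φ = a • φ := by
    have : Commute ((A₀ - A₁) * (A₀ - A₁)) (A₀ * B₀) :=
      ((commute_sub_mul_sub iA₀ iA₁).mul_left (cB0A.mul_right cB0A)).symm
    rw [hφ, ← Module.End.mul_apply, this.eq, Module.End.mul_apply, ha, map_smul]
  have hbφ : ((B₀ - B₁) * (B₀ - B₁)) φ = b • φ := by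
    have : Commute ((B₀ - B₁) * (B₀ - B₁)) (A₀ * B₀) :=
      ((cA0B.mul_right cA0B).mul_left (commute_sub_mul_sub iB₀ iB₁)).symm
    rw [hφ, ← Module.End.mul_apply, this.eq, Module.End.mul_apply, hb, map_smul]
  -- On vectors fixed by `A₀`, the compression `A₀ (1 - A₁) A₀` acts as `(A₀ - A₁)²`, hence as the
  -- scalar `a`.
  have hSA : A₀ ((1 - A₁) φ) = a • φ := by
    have := LinearMap.congr_fun (mul_one_sub_mul_eq iA₀ iA₁) φ
    simp only [Module.End.mul_apply, hAφ] at this haφ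
    rw [this, haφ]
  have hSB : B₀ ((1 - B₁) φ) = b • φ := by
    have := LinearMap.congr_fun (mul_one_sub_mul_eq iB₀ iB₁) φ
    simp only [Module.End.mul_apply, hBφ] at this hbφ
    rw [this, hbφ]
  have cA'B' : Commute (1 - A₁) (1 - B₁) :=
    (Commute.one_left _).sub_left ((Commute.one_right _).sub_right c₁₁)
  have cA'B0 : Commute (1 - A₁) B₀ := (Commute.one_left _).sub_left c₁₀
  have cA0B' : Commute A₀ (1 - B₁) := (Commute.one_right _).sub_right c₀₁
  have hα := norm_sq_projection_eq sA₁' iA₁' sA₀ hAφ hSA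
  have hβ := norm_sq_projection_eq sB₁' iB₁' sB₀ hBφ hSB
  have hABφ : (A₀ * B₀) φ = φ := by rw [Module.End.mul_apply, hBφ, hAφ]
  have hSAB : (A₀ * B₀) (((1 - A₁) * (1 - B₁)) φ) = (a * b) • φ := by
    have : A₀ * B₀ * ((1 - A₁) * (1 - B₁)) = A₀ * (1 - A₁) * (B₀ * (1 - B₁)) :=
      cA'B0.symm.mul_mul_mul_comm _ _
    rw [← Module.End.mul_apply, this, Module.End.mul_apply, Module.End.mul_apply B₀, hSB,
      map_smul, Module.End.mul_apply, hSA, smul_smul, mul_comm]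
  have sA'B' := isSymmetric_mul sA₁' sB₁' cA'B'
  have sAB := isSymmetric_mul sA₀ sB₀ c₀₀
  have hy := norm_sq_projection_eq sA'B' (mul_mul_mul_self iA₁' iB₁' cA'B') sAB hABφ hSAB
  -- The squared norms of `(1 - A₁) φ`, `(1 - B₁) φ` and their joint analogue are `a`, `b` and `ab`
  -- times `‖φ‖²`: the multiplicativity gained from joint eigenvectors.
  have hyn : ‖((1 - A₁) * (1 - B₁)) φ‖ * ‖φ‖ = ‖(1 - A₁) φ‖ * ‖(1 - B₁) φ‖ := by
    refine (sq_eq_sq₀ (by positivity) (by positivity)).1 ?_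
    rw [mul_pow, mul_pow]
    have : ((‖((1 - A₁) * (1 - B₁)) φ‖ : ℝ) : ℂ) ^ 2 * (‖φ‖ : ℂ) ^ 2 =
        (‖(1 - A₁) φ‖ : ℂ) ^ 2 * (‖(1 - B₁) φ‖ : ℂ) ^ 2 := by
      rw [hy, hα, hβ]; ring
    exact_mod_cast this
  have hα' : ‖(1 - A₁) φ‖ ≤ ‖((1 - A₁) * B₀) ψ‖ + ‖((1 - A₀) * B₀) ψ‖ := by
    -- Substitute `A₀ = 1 - (1 - A₀)` in `φ = A₀ B₀ ψ`.
    have e : (1 - A₁) φ = ((1 - A₁) * B₀) ψ - (1 - A₁) (((1 - A₀) * B₀) ψ) := by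
      simp only [hφ, Module.End.mul_apply, LinearMap.sub_apply, Module.End.one_apply, map_sub]
      abel
    rw [e]
    exact (norm_sub_le _ _).trans (by gcongr; exact norm_projection_le sA₁' iA₁' _)
  have hβ' : ‖(1 - B₁) φ‖ ≤ ‖(A₀ * (1 - B₁)) ψ‖ + ‖(A₀ * (1 - B₀)) ψ‖ := by
    have e : (1 - B₁) φ = (A₀ * (1 - B₁)) ψ - (1 - B₁) ((A₀ * (1 - B₀)) ψ) := by
      rw [cA0B'.eq]
      simp only [hφ, Module.End.mul_apply, LinearMap.sub_apply, Module.End.one_apply, map_sub]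
      abel
    rw [e]
    exact (norm_sub_le _ _).trans (by gcongr; exact norm_projection_le sB₁' iB₁' _)
  have hmain : ‖φ‖ ^ 2 ≤ ‖φ‖ * (‖(A₀ * (1 - B₁)) ψ‖ + ‖((1 - A₁) * B₀) ψ‖ + ‖(A₁ * B₁) ψ‖) +
      ‖((1 - A₁) * (1 - B₁)) φ‖ * ‖ψ‖ := by
    have h0 : inner ℂ φ ψ = ((‖φ‖ : ℝ) : ℂ) ^ 2 := by
      rw [hφ, inner_projection_left sAB (mul_mul_mul_self iA₀ iB₀ c₀₀), inner_self_eq_norm_sq_to_K]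
      rfl
    -- Hardy's argument as an operator identity: paired with `φ`, the first three terms are
    -- controlled by the errors, and only the last can be large.
    have hψ : ψ = (1 - B₁) ψ + (1 - A₁) ψ + (A₁ * B₁) ψ - ((1 - A₁) * (1 - B₁)) ψ := by
      simp only [Module.End.mul_apply, LinearMap.sub_apply, Module.End.one_apply, map_sub]
      abel
    have h1 : ‖φ‖ ^ 2 = ‖inner ℂ φ ψ‖ := by rw [h0]; simp
    have k1 : ‖inner ℂ φ ((1 - B₁) ψ)‖ ≤ ‖φ‖ * ‖(A₀ * (1 - B₁)) ψ‖ :=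
      norm_inner_le_of_fixed sA₀ hAφ _
    have k2 : ‖inner ℂ φ ((1 - A₁) ψ)‖ ≤ ‖φ‖ * ‖((1 - A₁) * B₀) ψ‖ := by
      rw [cA'B0.eq]
      exact norm_inner_le_of_fixed sB₀ hBφ _
    have k3 : ‖inner ℂ φ ((A₁ * B₁) ψ)‖ ≤ ‖φ‖ * ‖(A₁ * B₁) ψ‖ := norm_inner_le_norm _ _
    have k4 : ‖inner ℂ φ (((1 - A₁) * (1 - B₁)) ψ)‖ ≤ ‖((1 - A₁) * (1 - B₁)) φ‖ * ‖ψ‖ := by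
      rw [← sA'B']
      exact norm_inner_le_norm _ _
    have k5 : ‖inner ℂ φ ψ‖ ≤ ‖inner ℂ φ ((1 - B₁) ψ)‖ + ‖inner ℂ φ ((1 - A₁) ψ)‖ +
        ‖inner ℂ φ ((A₁ * B₁) ψ)‖ + ‖inner ℂ φ (((1 - A₁) * (1 - B₁)) ψ)‖ := by
      conv_lhs => rw [hψ, inner_sub_right, inner_add_right, inner_add_right]
      exact (norm_sub_le _ _).trans (by gcongr; exact norm_add₃_le)
    rw [h1]
    linarith
  exact ch_real_bound ht ht' (norm_nonneg _) (norm_nonneg _) (norm_nonneg _) (norm_nonneg _)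
    (norm_nonneg _) (norm_nonneg _) (norm_nonneg _) hmain hyn hα' hβ'

/-- The Clauser--Horne expression at efficiency `2/3 + t`, for two pairs of commuting projections,
is `O(t ^ 3)`. -/
theorem ch_le_of_projections [FiniteDimensional ℂ E] {A₀ A₁ B₀ B₁ : Module.End ℂ E}
    (sA₀ : LinearMap.IsSymmetric A₀) (sA₁ : LinearMap.IsSymmetric A₁)
    (sB₀ : LinearMap.IsSymmetric B₀) (sB₁ : LinearMap.IsSymmetric B₁)
    (iA₀ : A₀ * A₀ = A₀) (iA₁ : A₁ * A₁ = A₁) (iB₀ : B₀ * B₀ = B₀) (iB₁ : B₁ * B₁ = B₁)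
    (c₀₀ : Commute A₀ B₀) (c₀₁ : Commute A₀ B₁) (c₁₀ : Commute A₁ B₀) (c₁₁ : Commute A₁ B₁)
    (ψ : E) {t : ℝ} (ht : 0 < t) (ht' : t ≤ 1 / 144) :
    3 * t * ‖(A₀ * B₀) ψ‖ ^ 2 - (2 / 3 + t) * (‖(A₀ * (1 - B₁)) ψ‖ ^ 2 +
      ‖((1 - A₁) * B₀) ψ‖ ^ 2 + ‖(A₁ * B₁) ψ‖ ^ 2) -
      (1 / 3 - t) * (‖(A₀ * (1 - B₀)) ψ‖ ^ 2 + ‖((1 - A₀) * B₀) ψ‖ ^ 2) ≤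
      1728 * t ^ 3 * ‖ψ‖ ^ 2 := by
  have sA := sA₀.sub sA₁
  have sB := sB₀.sub sB₁
  have cAB : Commute (A₀ - A₁) (B₀ - B₁) :=
    (c₀₀.sub_right c₀₁).sub_left (c₁₀.sub_right c₁₁)
  -- Both squares commute with all four projections, so every norm in the inequality splits over the
  -- joint eigenvectors and the bound can be summed.
  obtain ⟨s, v, hv, hX⟩ := exists_joint_eigenvector_decomposition
    (isSymmetric_mul sA sA (Commute.refl _)) (isSymmetric_mul sB sB (Commute.refl _))
    ((cAB.mul_right cAB).mul_left (cAB.mul_right cAB)) ψ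
  have dA₀ := commute_sub_mul_sub iA₀ iA₁
  have dA₁ : Commute A₁ ((A₀ - A₁) * (A₀ - A₁)) := by
    have := commute_sub_mul_sub iA₁ iA₀
    rwa [← neg_sub A₀ A₁, neg_mul_neg] at this
  have dB₀ := commute_sub_mul_sub iB₀ iB₁
  have dB₁ : Commute B₁ ((B₀ - B₁) * (B₀ - B₁)) := by
    have := commute_sub_mul_sub iB₁ iB₀
    rwa [← neg_sub B₀ B₁, neg_mul_neg] at this
  have xA₀ : Commute A₀ ((B₀ - B₁) * (B₀ - B₁)) :=
    (c₀₀.sub_right c₀₁).mul_right (c₀₀.sub_right c₀₁)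
  have xA₁ : Commute A₁ ((B₀ - B₁) * (B₀ - B₁)) :=
    (c₁₀.sub_right c₁₁).mul_right (c₁₀.sub_right c₁₁)
  have xB₀ : Commute B₀ ((A₀ - A₁) * (A₀ - A₁)) :=
    (c₀₀.symm.sub_right c₁₀.symm).mul_right (c₀₀.symm.sub_right c₁₀.symm)
  have xB₁ : Commute B₁ ((A₀ - A₁) * (A₀ - A₁)) :=
    (c₀₁.symm.sub_right c₁₁.symm).mul_right (c₀₁.symm.sub_right c₁₁.symm)
  have one_sub {P Q : Module.End ℂ E} (h : Commute P Q) : Commute (1 - P) Q :=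
    (Commute.one_left _).sub_left h
  have h1 := hX 1 (Commute.one_left _) (Commute.one_left _)
  simp only [Module.End.one_apply] at h1
  rw [hX _ (dA₀.mul_left xB₀) (xA₀.mul_left dB₀),
    hX _ (dA₀.mul_left (one_sub xB₁)) (xA₀.mul_left (one_sub dB₁)),
    hX _ ((one_sub dA₁).mul_left xB₀) ((one_sub xA₁).mul_left dB₀),
    hX _ (dA₁.mul_left xB₁) (xA₁.mul_left dB₁),
    hX _ (dA₀.mul_left (one_sub xB₀)) (xA₀.mul_left (one_sub dB₀)),
    hX _ ((one_sub dA₀).mul_left xB₀) ((one_sub xA₀).mul_left dB₀), h1,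
    ← Finset.sum_add_distrib, ← Finset.sum_add_distrib, ← Finset.sum_add_distrib, Finset.mul_sum,
    Finset.mul_sum, Finset.mul_sum, Finset.mul_sum, ← Finset.sum_sub_distrib,
    ← Finset.sum_sub_distrib]
  exact Finset.sum_le_sum fun k _ => ch_le_of_joint_eigenvector sA₀ sA₁ sB₀ sB₁ iA₀ iA₁ iB₀ iB₁
    c₀₀ c₀₁ c₁₀ c₁₁ (hv k).1 (hv k).2 ht ht'

end Operators

end PostSel

namespace PostSel

/-! ### From POVMs and density matrices to projections and vectors -/

section Matrices

variable {ι : Type} [Fintype ι] [DecidableEq ι]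

open scoped MatrixOrder Matrix.Norms.L2Operator in
theorem posSemidef_eq_conjTranspose_mul_self {A : Matrix ι ι ℂ} (hA : A.PosSemidef) :
    ∃ B : Matrix ι ι ℂ, A = B.conjTranspose * B :=
  CStarAlgebra.nonneg_iff_eq_star_mul_self.mp hA.nonneg

/-- Expectation values `tr (ρ Yᴴ Y)` as sums of squared norms. -/
theorem exists_vectors_trace_mul {ρ : Matrix ι ι ℂ} (hρ : ρ.PosSemidef) :
    ∃ v : ι → EuclideanSpace ℂ ι, ∀ Y : Matrix ι ι ℂ,
      (ρ * (Y.conjTranspose * Y)).trace.re = ∑ i, ‖Y.toEuclideanLin (v i)‖ ^ 2 := by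
  obtain ⟨R, rfl⟩ := posSemidef_eq_conjTranspose_mul_self hρ
  -- With `ρ = Rᴴ R`, the vectors are the columns of `Rᴴ`.
  refine ⟨fun i => WithLp.toLp 2 fun j => R.conjTranspose j i, fun Y => ?_⟩
  have h : (R.conjTranspose * R * (Y.conjTranspose * Y)).trace =
      ((Y * R.conjTranspose).conjTranspose * (Y * R.conjTranspose)).trace := by
    rw [Matrix.mul_assoc, Matrix.trace_mul_comm, Matrix.conjTranspose_mul,
      Matrix.conjTranspose_conjTranspose]
    simp only [Matrix.mul_assoc]
  rw [h, Matrix.trace, Complex.re_sum]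
  refine Finset.sum_congr rfl fun i _ => ?_
  rw [EuclideanSpace.norm_sq_eq, Matrix.diag_apply, Matrix.mul_apply, Complex.re_sum]
  refine Finset.sum_congr rfl fun j _ => ?_
  rw [Matrix.conjTranspose_apply, Matrix.toLpLin_toLp]
  change _ = ‖(Y * R.conjTranspose) j i‖ ^ 2
  rw [← Complex.normSq_eq_norm_sq, Complex.star_def, ← Complex.normSq_eq_conj_mul_self,
    Complex.ofReal_re]

theorem trace_mul_re_nonneg {ρ X : Matrix ι ι ℂ} (hρ : ρ.PosSemidef) (hX : X.PosSemidef) :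
    0 ≤ (ρ * X).trace.re := by
  obtain ⟨Y, rfl⟩ := posSemidef_eq_conjTranspose_mul_self hX
  obtain ⟨v, hv⟩ := exists_vectors_trace_mul hρ
  rw [hv]
  positivity

/-- A real linear functional on the effects is maximal at a projection. -/
theorem exists_projection_le {M : Matrix ι ι ℂ} (hM : M.PosSemidef) (hM' : (1 - M).PosSemidef)
    (L : Matrix ι ι ℂ →ₗ[ℝ] ℝ) :
    ∃ P : Matrix ι ι ℂ, P.IsHermitian ∧ P * P = P ∧ L M ≤ L P := by
  have hH := hM.isHermitian
  set σ := Unitary.conjStarAlgAut ℂ (Matrix ι ι ℂ) hH.eigenvectorUnitary with hσ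
  have hMσ : M = σ (Matrix.diagonal (RCLike.ofReal ∘ hH.eigenvalues)) := hH.spectral_theorem
  have h0 : ∀ i, 0 ≤ hH.eigenvalues i := hM.eigenvalues_nonneg
  have h1 : ∀ i, hH.eigenvalues i ≤ 1 := by
    have e : 1 - M = σ (Matrix.diagonal fun i => ((1 - hH.eigenvalues i : ℝ) : ℂ)) := by
      have : (Matrix.diagonal fun i => ((1 - hH.eigenvalues i : ℝ) : ℂ)) =
          1 - Matrix.diagonal (RCLike.ofReal ∘ hH.eigenvalues) := by
        rw [← Matrix.diagonal_one, Matrix.diagonal_sub]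
        congr 1; ext i; simp
      rw [this, map_sub, map_one, ← hMσ]
    rw [e, hσ, Unitary.conjStarAlgAut_apply,
      Matrix.IsUnit.posSemidef_star_right_conjugate_iff Unitary.isUnit_coe,
      Matrix.posSemidef_diagonal_iff] at hM'
    intro i
    have := hM' i
    rw [Complex.zero_le_real] at this
    linarith
  set g : ι → ℝ := fun i => L (σ (Matrix.single i i 1)) with hg
  have hL : ∀ d : ι → ℝ, L (σ (Matrix.diagonal fun i => (d i : ℂ))) = ∑ i, d i * g i := by
    intro d
    have : (Matrix.diagonal fun i => (d i : ℂ)) =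
        ∑ i, (d i : ℂ) • Matrix.single i i (1 : ℂ) := by
      simp only [Matrix.smul_single, smul_eq_mul, mul_one]
      exact (Matrix.sum_single_eq_diagonal _).symm
    rw [this, map_sum, map_sum]
    refine Finset.sum_congr rfl fun i _ => ?_
    rw [map_smul, Complex.coe_smul, map_smul, smul_eq_mul]
  -- In the eigenbasis of `M`, `L` is linear in the eigenvalues, which lie in `[0, 1]`; each is
  -- pushed to the endpoint favoured by the sign of its coefficient.
  set P := σ (Matrix.diagonal fun i => (((if 0 ≤ g i then 1 else 0 : ℝ)) : ℂ)) with hP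
  refine ⟨P, ?_, ?_, ?_⟩
  · rw [Matrix.IsHermitian, ← Matrix.star_eq_conjTranspose, hP, ← map_star,
      Matrix.star_eq_conjTranspose, Matrix.diagonal_conjTranspose]
    congr 2; ext i; simp
  · rw [hP, ← map_mul, Matrix.diagonal_mul_diagonal]
    congr 2; ext i; split_ifs <;> simp
  · have hMd := hL hH.eigenvalues
    rw [show (Matrix.diagonal fun i => (hH.eigenvalues i : ℂ)) =
      Matrix.diagonal (RCLike.ofReal ∘ hH.eigenvalues) from rfl, ← hMσ] at hMd
    rw [hMd, hP, hL]
    refine Finset.sum_le_sum fun i _ => ?_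
    split_ifs with hgi
    · exact mul_le_mul_of_nonneg_right (h1 i) hgi
    · rw [zero_mul]
      exact mul_nonpos_of_nonneg_of_nonpos (h0 i) (not_le.1 hgi).le

variable {m n : Type} [Fintype m] [DecidableEq m] [Fintype n] [DecidableEq n]

/-- The bilinear form `(X, Y) ↦ Re tr [ρ (X ⊗ Y)]`. -/
noncomputable def tensorValue (ρ : Matrix (m × n) (m × n) ℂ) :
    Matrix m m ℂ →ₗ[ℝ] Matrix n n ℂ →ₗ[ℝ] ℝ :=
  LinearMap.mk₂ ℝ (fun X Y => (ρ * (X ⊗ₖ Y)).trace.re)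
    (fun X X' Y => by rw [Matrix.add_kronecker, mul_add, Matrix.trace_add, Complex.add_re])
    (fun c X Y => by
      rw [Matrix.smul_kronecker, Matrix.mul_smul, Matrix.trace_smul, Complex.smul_re])
    (fun X Y Y' => by rw [Matrix.kronecker_add, mul_add, Matrix.trace_add, Complex.add_re])
    (fun c X Y => by
      rw [Matrix.kronecker_smul, Matrix.mul_smul, Matrix.trace_smul, Complex.smul_re])

theorem tensorValue_apply (ρ : Matrix (m × n) (m × n) ℂ) (X : Matrix m m ℂ) (Y : Matrix n n ℂ) :
    tensorValue ρ X Y = (ρ * (X ⊗ₖ Y)).trace.re := rfl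

theorem tensorValue_one_one {ρ : Matrix (m × n) (m × n) ℂ} (h : ρ.trace = 1) :
    tensorValue ρ 1 1 = 1 := by
  rw [tensorValue_apply, Matrix.one_kronecker_one, mul_one, h, Complex.one_re]

open scoped MatrixOrder in
theorem tensorValue_nonneg {ρ : Matrix (m × n) (m × n) ℂ} (hρ : ρ.PosSemidef) {X : Matrix m m ℂ}
    {Y : Matrix n n ℂ} (hX : X.PosSemidef) (hY : Y.PosSemidef) : 0 ≤ tensorValue ρ X Y :=
  trace_mul_re_nonneg hρ (hX.kronecker hY)

theorem tensorValue_ch_le_of_projections {ρ : Matrix (m × n) (m × n) ℂ} (hρ : ρ.PosSemidef)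
    (hρ' : ρ.trace = 1) {M₀ M₁ : Matrix m m ℂ} {N₀ N₁ : Matrix n n ℂ}
    (hM₀ : M₀.IsHermitian) (hM₁ : M₁.IsHermitian) (hN₀ : N₀.IsHermitian) (hN₁ : N₁.IsHermitian)
    (iM₀ : M₀ * M₀ = M₀) (iM₁ : M₁ * M₁ = M₁) (iN₀ : N₀ * N₀ = N₀) (iN₁ : N₁ * N₁ = N₁)
    {t : ℝ} (ht : 0 < t) (ht' : t ≤ 1 / 144) :
    (2 / 3 + t) * (tensorValue ρ M₀ N₀ + tensorValue ρ M₀ N₁ + tensorValue ρ M₁ N₀ -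
      tensorValue ρ M₁ N₁) - tensorValue ρ M₀ 1 - tensorValue ρ 1 N₀ ≤ 1728 * t ^ 3 := by
  obtain ⟨v, hv⟩ := exists_vectors_trace_mul hρ
  have hval : ∀ (X : Matrix m m ℂ) (Y : Matrix n n ℂ), X.IsHermitian → X * X = X →
      Y.IsHermitian → Y * Y = Y →
      tensorValue ρ X Y = ∑ i, ‖(X ⊗ₖ Y).toEuclideanLin (v i)‖ ^ 2 := by
    intro X Y hX iX hY iY
    rw [← hv, Matrix.conjTranspose_kronecker, hX.eq, hY.eq, ← Matrix.mul_kronecker_mul, iX, iY,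
      tensorValue_apply]
  have hsub : ∀ {k : Type} [Fintype k] [DecidableEq k] {X : Matrix k k ℂ}, X.IsHermitian →
      (1 - X).IsHermitian := fun h => Matrix.isHermitian_one.sub h
  let lA : Matrix m m ℂ → Module.End ℂ (EuclideanSpace ℂ (m × n)) :=
    fun X => (X ⊗ₖ (1 : Matrix n n ℂ)).toEuclideanLin
  let lB : Matrix n n ℂ → Module.End ℂ (EuclideanSpace ℂ (m × n)) :=
    fun Y => ((1 : Matrix m m ℂ) ⊗ₖ Y).toEuclideanLin
  have hAB : ∀ X Y, lA X * lB Y = (X ⊗ₖ Y).toEuclideanLin := by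
    intro X Y
    change (X ⊗ₖ (1 : Matrix n n ℂ)).toEuclideanLin ∘ₗ ((1 : Matrix m m ℂ) ⊗ₖ Y).toEuclideanLin = _
    rw [← Matrix.toLpLin_mul_same, ← Matrix.mul_kronecker_mul, mul_one, one_mul]
  have hBA : ∀ X Y, lB Y * lA X = (X ⊗ₖ Y).toEuclideanLin := by
    intro X Y
    change ((1 : Matrix m m ℂ) ⊗ₖ Y).toEuclideanLin ∘ₗ (X ⊗ₖ (1 : Matrix n n ℂ)).toEuclideanLin = _
    rw [← Matrix.toLpLin_mul_same, ← Matrix.mul_kronecker_mul, mul_one, one_mul]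
  have hA1 : ∀ X, 1 - lA X = lA (1 - X) := by
    intro X
    simp only [lA]
    rw [sub_eq_add_neg 1 X, Matrix.add_kronecker, Matrix.one_kronecker_one, map_add,
      ← neg_one_smul ℂ X, Matrix.smul_kronecker, map_smul, Matrix.toLpLin_one, neg_one_smul,
      ← sub_eq_add_neg]
    rfl
  have hB1 : ∀ Y, 1 - lB Y = lB (1 - Y) := by
    intro Y
    simp only [lB]
    rw [sub_eq_add_neg 1 Y, Matrix.kronecker_add, Matrix.one_kronecker_one, map_add,
      ← neg_one_smul ℂ Y, Matrix.kronecker_smul, map_smul, Matrix.toLpLin_one, neg_one_smul,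
      ← sub_eq_add_neg]
    rfl
  have sA : ∀ {X : Matrix m m ℂ}, X.IsHermitian → (lA X).IsSymmetric := fun {X} h => by
    rw [Matrix.isSymmetric_toEuclideanLin_iff, Matrix.IsHermitian, Matrix.conjTranspose_kronecker,
      h.eq, Matrix.conjTranspose_one]
  have sB : ∀ {Y : Matrix n n ℂ}, Y.IsHermitian → (lB Y).IsSymmetric := fun {Y} h => by
    rw [Matrix.isSymmetric_toEuclideanLin_iff, Matrix.IsHermitian, Matrix.conjTranspose_kronecker,
      h.eq, Matrix.conjTranspose_one]
  have iA : ∀ {X : Matrix m m ℂ}, X * X = X → lA X * lA X = lA X := fun {X} h => by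
    change (X ⊗ₖ (1 : Matrix n n ℂ)).toEuclideanLin ∘ₗ (X ⊗ₖ (1 : Matrix n n ℂ)).toEuclideanLin = _
    rw [← Matrix.toLpLin_mul_same, ← Matrix.mul_kronecker_mul, mul_one, h]
  have iB : ∀ {Y : Matrix n n ℂ}, Y * Y = Y → lB Y * lB Y = lB Y := fun {Y} h => by
    change ((1 : Matrix m m ℂ) ⊗ₖ Y).toEuclideanLin ∘ₗ ((1 : Matrix m m ℂ) ⊗ₖ Y).toEuclideanLin = _
    rw [← Matrix.toLpLin_mul_same, ← Matrix.mul_kronecker_mul, mul_one, h]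
  have cAB : ∀ X Y, Commute (lA X) (lB Y) := fun X Y => (hAB X Y).trans (hBA X Y).symm
  have hsum := Finset.sum_le_sum fun (i : m × n) (_ : i ∈ Finset.univ) =>
    ch_le_of_projections (sA hM₀) (sA hM₁) (sB hN₀) (sB hN₁) (iA iM₀) (iA iM₁) (iB iN₀) (iB iN₁)
      (cAB _ _) (cAB _ _) (cAB _ _) (cAB _ _) (v i) ht ht'
  simp only [hA1, hB1, hAB, Finset.sum_sub_distrib, ← Finset.mul_sum, Finset.sum_add_distrib]
    at hsum
  have hone : ∑ i, ‖v i‖ ^ 2 = 1 := by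
    rw [← tensorValue_one_one hρ', hval 1 1 Matrix.isHermitian_one (mul_one _)
      Matrix.isHermitian_one (mul_one _), Matrix.one_kronecker_one]
    simp
  rw [hone, ← hval _ _ hM₀ iM₀ hN₀ iN₀, ← hval _ _ hM₀ iM₀ (hsub hN₁) (one_sub_mul_self iN₁),
    ← hval _ _ (hsub hM₁) (one_sub_mul_self iM₁) hN₀ iN₀, ← hval _ _ hM₁ iM₁ hN₁ iN₁,
    ← hval _ _ hM₀ iM₀ (hsub hN₀) (one_sub_mul_self iN₀),
    ← hval _ _ (hsub hM₀) (one_sub_mul_self iM₀) hN₀ iN₀] at hsum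
  -- Expanding the complements by bilinearity turns the norm form, with coefficients `3η - 2 = 3t`
  -- and `1 - η = 1/3 - t`, into the Clauser–Horne form.
  simp only [map_sub, LinearMap.sub_apply] at hsum
  linarith

theorem tensorValue_ch_le {ρ : Matrix (m × n) (m × n) ℂ} (hρ : ρ.PosSemidef)
    (hρ' : ρ.trace = 1) {M₀ M₁ : Matrix m m ℂ} {N₀ N₁ : Matrix n n ℂ}
    (hM₀ : M₀.PosSemidef) (hM₁ : M₁.PosSemidef) (hN₀ : N₀.PosSemidef) (hN₁ : N₁.PosSemidef)
    (hM₀' : (1 - M₀).PosSemidef) (hM₁' : (1 - M₁).PosSemidef) (hN₀' : (1 - N₀).PosSemidef)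
    (hN₁' : (1 - N₁).PosSemidef) {t : ℝ} (ht : 0 < t) (ht' : t ≤ 1 / 144) :
    (2 / 3 + t) * (tensorValue ρ M₀ N₀ + tensorValue ρ M₀ N₁ + tensorValue ρ M₁ N₀ -
      tensorValue ρ M₁ N₁) - tensorValue ρ M₀ 1 - tensorValue ρ 1 N₀ ≤ 1728 * t ^ 3 := by
  set φ := tensorValue ρ with hφ
  -- Each functional is the coefficient of one effect. Effects of one party never multiply each
  -- other, so a party's two effects are replaced independently while the other's stay fixed.
  obtain ⟨P₀, hP₀, iP₀, l₁⟩ := exists_projection_le hM₀ hM₀'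
    ((2 / 3 + t) • (φ.flip N₀ + φ.flip N₁) - φ.flip 1)
  obtain ⟨P₁, hP₁, iP₁, l₂⟩ := exists_projection_le hM₁ hM₁'
    ((2 / 3 + t) • (φ.flip N₀ - φ.flip N₁))
  obtain ⟨R₀, hR₀, iR₀, l₃⟩ := exists_projection_le hN₀ hN₀'
    ((2 / 3 + t) • (φ P₀ + φ P₁) - φ 1)
  obtain ⟨R₁, hR₁, iR₁, l₄⟩ := exists_projection_le hN₁ hN₁'
    ((2 / 3 + t) • (φ P₀ - φ P₁))
  have := tensorValue_ch_le_of_projections hρ hρ' hP₀ hP₁ hR₀ hR₁ iP₀ iP₁ iR₀ iR₁ ht ht'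
  rw [← hφ] at this
  simp only [LinearMap.sub_apply, LinearMap.add_apply, LinearMap.smul_apply, LinearMap.flip_apply,
    smul_eq_mul] at l₁ l₂ l₃ l₄
  linarith

end Matrices

/-! ### Quantum behaviours -/

theorem IsPOVM.fin_two {d : Type} [Fintype d] [DecidableEq d] {M : Fin 2 → Matrix d d ℂ}
    (h : IsPOVM M) : M 1 = 1 - M 0 := by
  have := h.2
  rw [Fin.sum_univ_two] at this
  rw [← this]; abel

variable {Q : Behaviour (Fin 2) (Fin 2) (Fin 2) (Fin 2)}

theorem exists_tensorValue_of_mem_quantumSet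
    (hQ : Q ∈ quantumSet (Fin 2) (Fin 2) (Fin 2) (Fin 2)) :
    ∃ (m n : ℕ) (ρ : Matrix (Fin m × Fin n) (Fin m × Fin n) ℂ)
      (M : Fin 2 → Fin 2 → Matrix (Fin m) (Fin m) ℂ) (N : Fin 2 → Fin 2 → Matrix (Fin n) (Fin n) ℂ),
      ρ.PosSemidef ∧ ρ.trace = 1 ∧ (∀ x, IsPOVM (M x)) ∧ (∀ y, IsPOVM (N y)) ∧
      ∀ a b x y, Q a b x y = tensorValue ρ (M x a) (N y b) := by
  obtain ⟨m, n, ρ, M, N, hρ, hρ', hM, hN, h⟩ := hQ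
  refine ⟨m, n, ρ, M, N, hρ, hρ', hM, hN, fun a b x y => ?_⟩
  rw [tensorValue_apply, ← h, Complex.ofReal_re]

theorem nonneg_of_mem_quantumSet (hQ : Q ∈ quantumSet (Fin 2) (Fin 2) (Fin 2) (Fin 2))
    (a b x y : Fin 2) : 0 ≤ Q a b x y := by
  obtain ⟨m, n, ρ, M, N, hρ, hρ', hM, hN, h⟩ := exists_tensorValue_of_mem_quantumSet hQ
  rw [h]
  exact tensorValue_nonneg hρ ((hM x).1 a) ((hN y).1 b)

theorem noSignalling_of_mem_quantumSet (hQ : Q ∈ quantumSet (Fin 2) (Fin 2) (Fin 2) (Fin 2)) :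
    ∃ α β : Fin 2 → ℝ, (∀ x y, ∑ a, ∑ b, Q a b x y = 1) ∧
      (∀ x y, Q 0 0 x y + Q 0 1 x y = α x) ∧ (∀ x y, Q 0 0 x y + Q 1 0 x y = β y) := by
  obtain ⟨m, n, ρ, M, N, hρ, hρ', hM, hN, h⟩ := exists_tensorValue_of_mem_quantumSet hQ
  refine ⟨fun x => tensorValue ρ (M x 0) 1, fun y => tensorValue ρ 1 (N y 0), fun x y => ?_,
    fun x y => ?_, fun x y => ?_⟩
  · simp only [Fin.sum_univ_two, h, (hM x).fin_two, (hN y).fin_two, map_sub, LinearMap.sub_apply,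
      tensorValue_one_one hρ']
    ring
  · simp only [h, (hN y).fin_two, map_sub]
    ring
  · simp only [h, (hM x).fin_two, map_sub, LinearMap.sub_apply]
    ring

/-- The Clauser--Horne expression of a quantum behaviour at efficiency `2/3 + t`. -/
theorem ch_le_of_mem_quantumSet (hQ : Q ∈ quantumSet (Fin 2) (Fin 2) (Fin 2) (Fin 2)) {t : ℝ}
    (ht : 0 < t) (ht' : t ≤ 1 / 144) :
    (2 / 3 + t) * (Q 0 0 0 0 + Q 0 0 0 1 + Q 0 0 1 0 - Q 0 0 1 1) -
      (Q 0 0 0 1 + Q 0 1 0 1) - (Q 0 0 1 0 + Q 1 0 1 0) ≤ 1728 * t ^ 3 := by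
  obtain ⟨m, n, ρ, M, N, hρ, hρ', hM, hN, h⟩ := exists_tensorValue_of_mem_quantumSet hQ
  have eM : ∀ x, (1 - M x 0).PosSemidef := fun x => (hM x).fin_two ▸ (hM x).1 1
  have eN : ∀ y, (1 - N y 0).PosSemidef := fun y => (hN y).fin_two ▸ (hN y).1 1
  have := tensorValue_ch_le hρ hρ' ((hM 0).1 0) ((hM 1).1 0) ((hN 0).1 0) ((hN 1).1 0)
    (eM 0) (eM 1) (eN 0) (eN 1) ht ht'
  simp only [h, (hM 1).fin_two, (hN 1).fin_two, map_sub, LinearMap.sub_apply]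
  linarith

end PostSel

namespace PostSel

/-! ### The CHSH power at detection efficiency `η` -/

section Effective

variable {Q : Behaviour (Fin 2) (Fin 2) (Fin 2) (Fin 2)} {η : ℝ}

theorem detect_nonneg (hη : η ∈ Icc (0 : ℝ) 1) (a c : Fin 2) : 0 ≤ detect η a c := by
  obtain ⟨h0, h1⟩ := hη
  unfold detect
  split_ifs <;> linarith

theorem effective_nonneg (hη : η ∈ Icc (0 : ℝ) 1)
    (hQ : Q ∈ quantumSet (Fin 2) (Fin 2) (Fin 2) (Fin 2)) (c d x y : Fin 2) :
    0 ≤ effective η Q c d x y :=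
  Finset.sum_nonneg fun a _ => Finset.sum_nonneg fun b _ =>
    mul_nonneg (mul_nonneg (detect_nonneg hη a c) (detect_nonneg hη b d))
      (nonneg_of_mem_quantumSet hQ a b x y)

theorem sum_effective (hQ : Q ∈ quantumSet (Fin 2) (Fin 2) (Fin 2) (Fin 2)) (x y : Fin 2) :
    ∑ a, ∑ b, effective η Q a b x y = 1 := by
  obtain ⟨α, β, hsum, -, -⟩ := noSignalling_of_mem_quantumSet hQ
  have := hsum x y
  simp only [Fin.sum_univ_two, effective_zero_zero, effective_zero_one, effective_one_zero,
    effective_one_one] at this ⊢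
  linarith

/-- Recording losses as `1` multiplies joint probabilities of `00` by `η ^ 2` and marginals of `0`
by `η`; the Clauser–Horne form uses only these. -/
theorem chsh_effective (hQ : Q ∈ quantumSet (Fin 2) (Fin 2) (Fin 2) (Fin 2)) :
    chsh.postProb (effective η Q) = 1 ∧ chsh.winProb (effective η Q) = 3 / 4 +
      η / 2 * (η * (Q 0 0 0 0 + Q 0 0 0 1 + Q 0 0 1 0 - Q 0 0 1 1) -
        (Q 0 0 0 1 + Q 0 1 0 1) - (Q 0 0 1 0 + Q 1 0 1 0)) := by
  obtain ⟨α, β, hsum, hα, hβ⟩ := noSignalling_of_mem_quantumSet hQ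
  obtain ⟨h1, h2⟩ := chsh_winProb_of_noSignalling (P := effective η Q) (α := fun x => η * α x)
    (β := fun y => η * β y) (sum_effective hQ)
    (fun x y => by rw [effective_zero_zero, effective_zero_one, ← hα x y]; ring)
    (fun x y => by rw [effective_zero_zero, effective_one_zero, ← hβ x y]; ring)
  refine ⟨h1, h2.trans ?_⟩
  rw [effective_zero_zero, effective_zero_one, effective_one_zero, effective_zero_zero]
  ring

theorem chsh_winProb_effective_mem_Icc (hη : η ∈ Icc (0 : ℝ) 1)
    (hQ : Q ∈ quantumSet (Fin 2) (Fin 2) (Fin 2) (Fin 2)) :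
    chsh.winProb (effective η Q) ∈ Icc (0 : ℝ) 1 := by
  have h := effective_nonneg hη hQ
  have hs := sum_effective (η := η) hQ
  simp only [Fin.sum_univ_two] at hs
  rw [chsh_winProb, (chsh_effective hQ).1, div_one]
  constructor
  · linarith [h 0 0 0 0, h 1 1 0 0, h 0 0 0 1, h 1 1 0 1, h 0 0 1 0, h 1 1 1 0, h 0 1 1 1,
      h 1 0 1 1]
  · linarith [hs 0 0, hs 0 1, hs 1 0, hs 1 1, h 0 1 0 0, h 1 0 0 0, h 0 1 0 1, h 1 0 0 1,
      h 0 1 1 0, h 1 0 1 0, h 0 0 1 1, h 1 1 1 1]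

theorem chsh_power_effective_le (hη : η ∈ Icc (0 : ℝ) 1)
    (hQ : Q ∈ quantumSet (Fin 2) (Fin 2) (Fin 2) (Fin 2)) :
    chsh.power (effective η Q) ≤
      16 / 3 / Real.log 2 * (chsh.winProb (effective η Q) - 3 / 4) ^ 2 := by
  rw [PostSelectionGame.power, (chsh_effective hQ).1, one_mul, localBound_chsh]
  -- The constant `16/3` is the inverse of `3/4 * (1 - 3/4)`.
  refine (relEntropy_le (chsh_winProb_effective_mem_Icc hη hQ) (by norm_num)).trans (le_of_eq ?_)
  have := Real.log_pos one_lt_two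
  field_simp
  ring

theorem bddAbove_chshPowers (hη : η ∈ Icc (0 : ℝ) 1) : BddAbove (chshPowers η) := by
  refine ⟨16 / 3 / Real.log 2, ?_⟩
  rintro w ⟨Q, hQ, -, rfl⟩
  refine (chsh_power_effective_le hη hQ).trans ?_
  obtain ⟨h0, h1⟩ := chsh_winProb_effective_mem_Icc hη hQ
  have := Real.log_pos one_lt_two
  exact mul_le_of_le_one_right (by positivity) (by nlinarith)

theorem optChshPower_le {t : ℝ} (ht : 0 < t) (ht' : t ≤ 1 / 144)
    (hne : (chshPowers (2 / 3 + t)).Nonempty) :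
    optChshPower (2 / 3 + t) ≤ 16 / 3 / Real.log 2 * 864 ^ 2 * t ^ 6 := by
  have hη : 2 / 3 + t ∈ Icc (0 : ℝ) 1 := ⟨by linarith, by linarith⟩
  refine csSup_le hne ?_
  rintro w ⟨Q, hQ, hw, rfl⟩
  rw [localBound_chsh] at hw
  refine (chsh_power_effective_le hη hQ).trans ?_
  have h1 := ch_le_of_mem_quantumSet hQ ht ht'
  have h2 := (chsh_effective (η := 2 / 3 + t) hQ).2
  have h3 : chsh.winProb (effective (2 / 3 + t) Q) - 3 / 4 ≤ 864 * t ^ 3 := by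
    rw [h2, add_sub_cancel_left]
    refine (mul_le_mul_of_nonneg_left h1 (by linarith [hη.1])).trans ?_
    have : (2 / 3 + t) / 2 * (1728 * t ^ 3) ≤ 1 / 2 * (1728 * t ^ 3) := by
      gcongr
      linarith [hη.2]
    linarith
  have := Real.log_pos one_lt_two
  calc 16 / 3 / Real.log 2 * (chsh.winProb (effective (2 / 3 + t) Q) - 3 / 4) ^ 2
      ≤ 16 / 3 / Real.log 2 * (864 * t ^ 3) ^ 2 := by
        -- Squaring the one-sided bound needs the excess to be nonnegative; this is where the
        -- constraint defining `chshPowers` enters.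
        gcongr
    _ = _ := by ring

end Effective

/-! ### Hardy's behaviour -/

theorem one_div_sqrt_sq {x : ℝ} (hx : 0 ≤ x) : (1 / √x) ^ 2 = 1 / x := by
  rw [div_pow, one_pow, Real.sq_sqrt hx]

theorem hardyVec_sum_mul {α β : ℝ} (h : α ^ 2 + β ^ 2 = 1) (x i j : Fin 2) :
    ∑ a, hardyVec α β x a i * hardyVec α β x a j = if i = j then 1 else 0 := by
  fin_cases x <;> fin_cases i <;> fin_cases j <;> simp [hardyVec, Fin.sum_univ_two] <;> linarith

theorem isPOVM_hardyVec {α β : ℝ} (h : α ^ 2 + β ^ 2 = 1) (x : Fin 2) :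
    IsPOVM fun a : Fin 2 => Matrix.vecMulVec (fun i => (hardyVec α β x a i : ℂ))
      (star fun i => (hardyVec α β x a i : ℂ)) := by
  refine ⟨fun a => Matrix.posSemidef_vecMulVec_self_star _, ?_⟩
  ext i j
  have := hardyVec_sum_mul h x i j
  rw [Matrix.sum_apply, Matrix.one_apply]
  simp only [Matrix.vecMulVec_apply, Pi.star_apply, Complex.star_def, Complex.conj_ofReal]
  rw [show (if i = j then (1 : ℂ) else 0) = ((if i = j then (1 : ℝ) else 0 : ℝ) : ℂ) by
    split_ifs <;> simp, ← this]
  push_cast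
  rfl

theorem hardyBehaviour_mem_quantumSet {α β : ℝ} (h : α ^ 2 + β ^ 2 = 1) (hβ : 0 < β) :
    hardyBehaviour α β ∈ quantumSet (Fin 2) (Fin 2) (Fin 2) (Fin 2) := by
  let ψ : Fin 2 × Fin 2 → ℂ := fun k => (hardyState α β k.1 k.2 : ℂ)
  refine ⟨2, 2, Matrix.vecMulVec ψ (star ψ), _, _, Matrix.posSemidef_vecMulVec_self_star ψ, ?_,
    isPOVM_hardyVec h, isPOVM_hardyVec h, fun a b x y => ?_⟩
  · have hpos : 0 < 2 * α ^ 2 * β ^ 2 + β ^ 4 := by positivity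
    have hnorm : ∑ i, ∑ j, hardyState α β i j * hardyState α β i j = 1 := by
      have hc := one_div_sqrt_sq hpos.le
      simp only [hardyState]
      set c := 1 / √(2 * α ^ 2 * β ^ 2 + β ^ 4)
      have e : ∑ i : Fin 2, ∑ j : Fin 2, c * !![0, α * β; α * β, β ^ 2] i j *
          (c * !![0, α * β; α * β, β ^ 2] i j) = c ^ 2 * (2 * α ^ 2 * β ^ 2 + β ^ 4) := by
        simp [Fin.sum_univ_two]; ring
      rw [e, hc, one_div_mul_cancel hpos.ne']
    rw [Matrix.trace, Fintype.sum_prod_type]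
    simp only [Matrix.diag_apply, Matrix.vecMulVec_apply, Pi.star_apply, Complex.star_def, ψ,
      Complex.conj_ofReal]
    exact_mod_cast hnorm
  · simp only [hardyBehaviour, Matrix.trace, Matrix.diag_apply, Matrix.mul_apply,
      Fintype.sum_prod_type, Matrix.kroneckerMap_apply, Matrix.vecMulVec_apply, Pi.star_apply,
      Complex.star_def, ψ, Complex.conj_ofReal, Fin.sum_univ_two]
    push_cast
    ring

section HardyFamily

variable {α β : ℝ}

theorem hardyState_normalization (h : α ^ 2 + β ^ 2 = 1) :
    2 * α ^ 2 * β ^ 2 + β ^ 4 = β ^ 2 * (1 + α ^ 2) := by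
  rw [show β ^ 4 = β ^ 2 * β ^ 2 by ring, eq_sub_of_add_eq' h]; ring

theorem hardyBehaviour_eq (a b x y : Fin 2) (h : α ^ 2 + β ^ 2 = 1) :
    hardyBehaviour α β a b x y = 1 / (β ^ 2 * (1 + α ^ 2)) * (∑ i, ∑ j, hardyVec α β x a i *
      hardyVec α β y b j * !![0, α * β; α * β, β ^ 2] i j) ^ 2 := by
  rw [← hardyState_normalization h, ← one_div_sqrt_sq (by positivity), ← mul_pow, Finset.mul_sum,
    hardyBehaviour]
  congr 1
  refine Finset.sum_congr rfl fun i _ => ?_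
  rw [Finset.mul_sum]
  refine Finset.sum_congr rfl fun j _ => ?_
  rw [hardyState]; ring

theorem hardyBehaviour_zeros (h : α ^ 2 + β ^ 2 = 1) :
    hardyBehaviour α β 0 1 0 1 = 0 ∧ hardyBehaviour α β 1 0 1 0 = 0 ∧
      hardyBehaviour α β 0 0 1 1 = 0 := by
  refine ⟨?_, ?_, ?_⟩ <;> rw [hardyBehaviour_eq _ _ _ _ h] <;>
    simp [hardyVec, Fin.sum_univ_two] <;> right <;> ring

theorem hardyBehaviour_values (h : α ^ 2 + β ^ 2 = 1) (hβ : 0 < β) :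
    hardyBehaviour α β 0 0 0 0 = (α ^ 2) ^ 2 * (1 - α ^ 2) / (1 + α ^ 2) ∧
      hardyBehaviour α β 0 0 0 1 = (α ^ 2) ^ 2 / (1 + α ^ 2) ∧
      hardyBehaviour α β 0 0 1 0 = (α ^ 2) ^ 2 / (1 + α ^ 2) := by
  have hα : 0 < 1 + α ^ 2 := by positivity
  have hb : 1 - α ^ 2 = β ^ 2 := by linarith
  refine ⟨?_, ?_, ?_⟩ <;> rw [hardyBehaviour_eq _ _ _ _ h] <;>
    simp [hardyVec, Fin.sum_univ_two] <;> rw [← sub_eq_zero] <;> try rw [hb]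
  all_goals field_simp
  all_goals ring

end HardyFamily

theorem sqrt_five_mem : √5 ∈ Ioo (2.236 : ℝ) 2.2361 :=
  ⟨Real.lt_sqrt_of_sq_lt (by norm_num), (Real.sqrt_lt' (by norm_num)).2 (by norm_num)⟩

theorem zParam_mem {η : ℝ} (hη : η ∈ Ioc (2 / 3 : ℝ) 1) : zParam η ∈ Ioo (0 : ℝ) 1 := by
  obtain ⟨h1, h2⟩ := hη
  obtain ⟨h3, h4⟩ := sqrt_five_mem
  unfold zParam
  constructor
  · have : 0 < √5 - 1 := by linarith
    have : 0 < η - 2 / 3 := by linarith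
    positivity
  · nlinarith

section Family

variable {η : ℝ}

theorem sq_add_sq_hardyFamily (hη : η ∈ Ioc (2 / 3 : ℝ) 1) :
    √(zParam η) ^ 2 + √(1 - zParam η) ^ 2 = 1 := by
  obtain ⟨h1, h2⟩ := zParam_mem hη
  rw [Real.sq_sqrt h1.le, Real.sq_sqrt (by linarith)]; ring

theorem hardyFamily_mem_quantumSet (hη : η ∈ Ioc (2 / 3 : ℝ) 1) :
    hardyFamily η ∈ quantumSet (Fin 2) (Fin 2) (Fin 2) (Fin 2) :=
  hardyBehaviour_mem_quantumSet (sq_add_sq_hardyFamily hη)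
    (Real.sqrt_pos.2 (sub_pos.2 (zParam_mem hη).2))

theorem hardyFamily_zeros (hη : η ∈ Ioc (2 / 3 : ℝ) 1) :
    hardyFamily η 0 1 0 1 = 0 ∧ hardyFamily η 1 0 1 0 = 0 ∧ hardyFamily η 0 0 1 1 = 0 :=
  hardyBehaviour_zeros (sq_add_sq_hardyFamily hη)

theorem hardyFamily_values (hη : η ∈ Ioc (2 / 3 : ℝ) 1) :
    hardyFamily η 0 0 0 0 = zParam η ^ 2 * (1 - zParam η) / (1 + zParam η) ∧
      hardyFamily η 0 0 0 1 = zParam η ^ 2 / (1 + zParam η) ∧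
      hardyFamily η 0 0 1 0 = zParam η ^ 2 / (1 + zParam η) := by
  have := hardyBehaviour_values (sq_add_sq_hardyFamily hη)
    (Real.sqrt_pos.2 (sub_pos.2 (zParam_mem hη).2))
  rwa [Real.sq_sqrt (zParam_mem hη).1.le] at this

theorem isHardyBehaviour_hardyFamily (hη : η ∈ Ioc (2 / 3 : ℝ) 1) :
    IsHardyBehaviour (hardyFamily η) := by
  obtain ⟨h1, h2, h3⟩ := hardyFamily_zeros hη
  refine ⟨hardyFamily_mem_quantumSet hη, h1, h2, h3, ?_⟩
  rw [(hardyFamily_values hη).1]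
  obtain ⟨h4, h5⟩ := zParam_mem hη
  have : 0 < 1 - zParam η := by linarith
  positivity

/-- With `z₀ = (√5 - 1) / 2`, the expression factors as `3 (η - 2/3) (1 - η z₀)`, and `z₀ < 1`. Its
sign gives violation in both the CHSH and the Hardy test. -/
theorem hardyFamily_gain_pos (hη : η ∈ Ioc (2 / 3 : ℝ) 1) :
    0 < η * (1 - zParam η) - 2 * (1 - η) := by
  obtain ⟨h1, h2⟩ := hη
  obtain ⟨h3, h4⟩ := sqrt_five_mem
  have : 0 < 3 * (η - 2 / 3) * (1 - η * ((√5 - 1) / 2)) := by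
    have : 0 < η - 2 / 3 := by linarith
    have : 0 < 1 - η * ((√5 - 1) / 2) := by nlinarith
    positivity
  unfold zParam
  linarith

theorem chsh_winProb_hardyFamily (hη : η ∈ Ioc (2 / 3 : ℝ) 1) :
    3 / 4 < chsh.winProb (effective η (hardyFamily η)) := by
  obtain ⟨h1, h2, h3⟩ := hardyFamily_zeros hη
  obtain ⟨h4, h5, h6⟩ := hardyFamily_values hη
  obtain ⟨z0, z1⟩ := zParam_mem hη
  rw [(chsh_effective (hardyFamily_mem_quantumSet hη)).2, h1, h2, h3, h4, h5, h6]
  have hη0 : 0 < η := by linarith [hη.1]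
  have : 0 < η / 2 * (zParam η ^ 2 / (1 + zParam η) * (η * (1 - zParam η) - 2 * (1 - η))) := by
    have := hardyFamily_gain_pos hη
    positivity
  have e : η * (zParam η ^ 2 * (1 - zParam η) / (1 + zParam η) + zParam η ^ 2 / (1 + zParam η) +
      zParam η ^ 2 / (1 + zParam η) - 0) - (zParam η ^ 2 / (1 + zParam η) + 0) -
      (zParam η ^ 2 / (1 + zParam η) + 0) =
      zParam η ^ 2 / (1 + zParam η) * (η * (1 - zParam η) - 2 * (1 - η)) := by ring
  rw [e]
  linarith

theorem hardyFamily_power_mem (hη : η ∈ Ioc (2 / 3 : ℝ) 1) :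
    chsh.power (effective η (hardyFamily η)) ∈ chshPowers η :=
  ⟨_, hardyFamily_mem_quantumSet hη, by
    rw [localBound_chsh]; exact (chsh_winProb_hardyFamily hη).le, rfl⟩

theorem optChshPower_pos (hη : η ∈ Ioc (2 / 3 : ℝ) 1) : 0 < optChshPower η := by
  have hη' : η ∈ Icc (0 : ℝ) 1 := ⟨by linarith [hη.1], hη.2⟩
  refine lt_of_lt_of_le ?_ (le_csSup (bddAbove_chshPowers hη') (hardyFamily_power_mem hη))
  have hQ := hardyFamily_mem_quantumSet hη
  have hw := chsh_winProb_hardyFamily hη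
  rw [PostSelectionGame.power, (chsh_effective hQ).1, one_mul, localBound_chsh]
  exact relEntropy_pos ⟨by linarith, (chsh_winProb_effective_mem_Icc hη' hQ).2⟩ (by norm_num)
    hw.ne'

/-- The losing events occur only through lost photons, from `(00|01)` and `(00|10)`. All surviving
terms share the factor `η z² / (1 + z)`, which cancels in the winning probability but not in the
post-selection probability. -/
theorem hardy_power_hardyFamily (hη : η ∈ Ioc (2 / 3 : ℝ) 1) :
    hardy.power (effective η (hardyFamily η)) =
      η * zParam η ^ 2 / (4 * (1 + zParam η)) * (η * (1 - zParam η) + 2 * (1 - η)) *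
      relEntropy (1 / 2 + (η * (1 - zParam η) - 2 * (1 - η)) /
        (2 * (η * (1 - zParam η) + 2 * (1 - η)))) (1 / 2) := by
  obtain ⟨h1, h2, h3⟩ := hardyFamily_zeros hη
  obtain ⟨h4, h5, h6⟩ := hardyFamily_values hη
  obtain ⟨z0, z1⟩ := zParam_mem hη
  have hη0 : 0 < η := by linarith [hη.1]
  have hη1 : 0 ≤ 1 - η := by linarith [hη.2]
  have z1' : 0 < 1 - zParam η := by linarith
  have hd : 0 < η * (1 - zParam η) + 2 * (1 - η) := by positivity
  rw [PostSelectionGame.power, localBound_hardy, hardy_postProb, hardy_winProb,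
    effective_zero_zero, effective_zero_one, effective_one_zero, effective_zero_zero,
    h1, h2, h3, h4, h5, h6]
  have hc : 0 < η * zParam η ^ 2 / (1 + zParam η) := by positivity
  have e : η ^ 2 * (zParam η ^ 2 * (1 - zParam η) / (1 + zParam η)) +
      (η * 0 + η * (1 - η) * (zParam η ^ 2 / (1 + zParam η))) +
      (η * 0 + η * (1 - η) * (zParam η ^ 2 / (1 + zParam η))) + η ^ 2 * 0 =
      η * zParam η ^ 2 / (1 + zParam η) * (η * (1 - zParam η) + 2 * (1 - η)) := by ring
  rw [e, show η ^ 2 * (zParam η ^ 2 * (1 - zParam η) / (1 + zParam η)) =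
    η * zParam η ^ 2 / (1 + zParam η) * (η * (1 - zParam η)) by ring,
    mul_div_mul_left _ _ hc.ne']
  congr 2
  · field_simp
  · field_simp
    ring

end Family

/-! ### Asymptotics at the threshold efficiency -/

theorem tendsto_hardy_power :
    Tendsto (fun η : ℝ => hardy.power (effective η (hardyFamily η)) / (η - 2 / 3) ^ 4)
      (𝓝[>] (2 / 3)) (𝓝 ((2781 - 1215 * √5) / (4 * Real.log 2) / (Nat.factorial 4 : ℝ))) := by
  set z₀ : ℝ := (√5 - 1) / 2 with hz₀
  set δ : ℝ → ℝ := fun η => (η * (1 - zParam η) - 2 * (1 - η)) /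
    (2 * (η * (1 - zParam η) + 2 * (1 - η))) with hδ
  -- `r` is the excess `δ` with its factor `η - 2/3` removed, so it is continuous and nonzero at the
  -- threshold; `γ` below likewise drops `(η - 2/3)²` from the post-selection probability.
  set r : ℝ → ℝ := fun η => 3 * (1 - η * z₀) / (2 * (η * (1 - zParam η) + 2 * (1 - η))) with hr
  have hz : Continuous zParam := by unfold zParam; fun_prop
  have hz23 : zParam (2 / 3) = 0 := by simp [zParam]
  have hmem : ∀ᶠ η : ℝ in 𝓝[>] (2 / 3), η ∈ Ioc (2 / 3 : ℝ) 1 :=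
    Ioc_mem_nhdsGT (by norm_num)
  have hrlim : Tendsto r (𝓝[>] (2 / 3)) (𝓝 (r (2 / 3))) := by
    have : ContinuousAt r (2 / 3) := by
      refine ContinuousAt.div (by fun_prop) (by fun_prop) ?_
      rw [hz23]; norm_num
    exact this.tendsto.mono_left nhdsWithin_le_nhds
  have hδr : ∀ η, δ η = (η - 2 / 3) * r η := by
    intro η
    simp only [hδ, hr]
    rw [← mul_div_assoc]
    congr 1
    unfold zParam
    ring
  have hδlim : Tendsto δ (𝓝[>] (2 / 3)) (𝓝[≠] 0) := by
    refine tendsto_nhdsWithin_iff.2 ⟨?_, ?_⟩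
    · have h1 : Tendsto (fun η : ℝ => η - 2 / 3) (𝓝[>] (2 / 3)) (𝓝 0) := by
        have : Continuous fun η : ℝ => η - 2 / 3 := by fun_prop
        simpa using (this.tendsto (2 / 3)).mono_left nhdsWithin_le_nhds
      have := h1.mul hrlim
      rw [zero_mul] at this
      exact this.congr fun η => (hδr η).symm
    · filter_upwards [hmem] with η hη
      have h1 := hardyFamily_gain_pos hη
      have : 0 ≤ 1 - η := by linarith [hη.2]
      have h2 : 0 < η * (1 - zParam η) + 2 * (1 - η) := by linarith
      simp only [hδ]
      exact (div_pos h1 (by linarith)).ne'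
  have hent := (tendsto_relEntropy_half.comp hδlim)
  set γ : ℝ → ℝ := fun η => η * (3 * z₀) ^ 2 / (4 * (1 + zParam η)) *
    (η * (1 - zParam η) + 2 * (1 - η)) with hγ
  have hγlim : Tendsto γ (𝓝[>] (2 / 3)) (𝓝 (γ (2 / 3))) := by
    have : ContinuousAt γ (2 / 3) := by
      refine ContinuousAt.mul (ContinuousAt.div (by fun_prop) (by fun_prop) ?_) (by fun_prop)
      rw [hz23]; norm_num
    exact this.tendsto.mono_left nhdsWithin_le_nhds
  have hlim := (hγlim.mul (hrlim.pow 2)).mul hent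
  have hval : γ (2 / 3) * r (2 / 3) ^ 2 * (2 / Real.log 2) =
      (2781 - 1215 * √5) / (4 * Real.log 2) / (Nat.factorial 4 : ℝ) := by
    have h5 : √5 ^ 2 = 5 := Real.sq_sqrt (by norm_num)
    have hl := Real.log_pos one_lt_two
    have hg : γ (2 / 3) = 2 * z₀ ^ 2 := by simp only [hγ, hz23]; ring
    have hr' : r (2 / 3) = 3 / 8 * (3 - 2 * z₀) := by simp only [hr, hz23]; ring
    have h24 : (Nat.factorial 4 : ℝ) = 24 := by norm_num [Nat.factorial]
    have hz2 : z₀ ^ 2 = 1 - z₀ := by rw [hz₀]; linarith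
    -- Reduction modulo `z₀² + z₀ - 1`; the coefficient below is the quotient of the polynomial
    -- division.
    have hprod : z₀ ^ 2 * (3 - 2 * z₀) ^ 2 = 29 - 45 * z₀ := by
      linear_combination (4 * z₀ ^ 2 - 16 * z₀ + 29) * hz2
    rw [hg, hr', h24]
    have : 2 * z₀ ^ 2 * (3 / 8 * (3 - 2 * z₀)) ^ 2 * (2 / Real.log 2) =
        9 / 16 * (z₀ ^ 2 * (3 - 2 * z₀) ^ 2) / Real.log 2 := by ring
    rw [this, hprod, hz₀]
    field_simp
    ring
  rw [hval] at hlim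
  refine hlim.congr' ?_
  filter_upwards [hmem, hδlim.eventually self_mem_nhdsWithin] with η hη hδ0
  rw [hardy_power_hardyFamily hη]
  change γ η * r η ^ 2 * (relEntropy (1 / 2 + δ η) (1 / 2) / δ η ^ 2) =
    η * zParam η ^ 2 / (4 * (1 + zParam η)) * (η * (1 - zParam η) + 2 * (1 - η)) *
      relEntropy (1 / 2 + δ η) (1 / 2) / (η - 2 / 3) ^ 4
  have ht : η - 2 / 3 ≠ 0 := (sub_pos.2 hη.1).ne'
  have hr0 : r η ≠ 0 := fun h => hδ0 (by rw [hδr, h, mul_zero]; rfl)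
  have hg : η * zParam η ^ 2 / (4 * (1 + zParam η)) * (η * (1 - zParam η) + 2 * (1 - η)) =
      γ η * (η - 2 / 3) ^ 2 := by
    simp only [hγ]
    have : zParam η = 3 * z₀ * (η - 2 / 3) := rfl
    rw [show zParam η ^ 2 = (3 * z₀) ^ 2 * (η - 2 / 3) ^ 2 by rw [this]; ring]
    ring
  rw [hg]
  generalize relEntropy (1 / 2 + δ η) (1 / 2) = D
  rw [hδr]
  field_simp

theorem eventually_optChshPower :
    ∀ᶠ η : ℝ in 𝓝[>] (2 / 3), 0 < η - 2 / 3 ∧ 0 < optChshPower η ∧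
      optChshPower η ≤ 16 / 3 / Real.log 2 * 864 ^ 2 * (η - 2 / 3) ^ 6 := by
  filter_upwards [Ioc_mem_nhdsGT (show (2 / 3 : ℝ) < 2 / 3 + 1 / 144 by norm_num)] with η hη
  have hη' : η ∈ Ioc (2 / 3 : ℝ) 1 := ⟨hη.1, hη.2.trans (by norm_num)⟩
  have := optChshPower_le (t := η - 2 / 3) (sub_pos.2 hη.1) (by linarith [hη.2])
  rw [add_sub_cancel] at this
  exact ⟨sub_pos.2 hη.1, optChshPower_pos hη', this ⟨_, hardyFamily_power_mem hη'⟩⟩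

theorem tendsto_powerRatio :
    Tendsto (fun η : ℝ => powerRatio η (hardyFamily η)) (𝓝[>] (2 / 3)) atTop := by
  set C : ℝ := 16 / 3 / Real.log 2 * 864 ^ 2 with hC
  have hl := Real.log_pos one_lt_two
  have hC0 : 0 < C := by positivity
  have hc : 0 < (2781 - 1215 * √5) / (4 * Real.log 2) / (Nat.factorial 4 : ℝ) := by
    have : 0 < 2781 - 1215 * √5 := by linarith [sqrt_five_mem.2]
    have : 0 < (Nat.factorial 4 : ℝ) := by positivity
    positivity
  have hinv : Tendsto (fun η : ℝ => (C * (η - 2 / 3) ^ 2)⁻¹) (𝓝[>] (2 / 3)) atTop := by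
    refine Tendsto.inv_tendsto_nhdsGT_zero (tendsto_nhdsWithin_iff.2 ⟨?_, ?_⟩)
    · have : Continuous fun η : ℝ => C * (η - 2 / 3) ^ 2 := by fun_prop
      simpa using (this.tendsto (2 / 3)).mono_left nhdsWithin_le_nhds
    · filter_upwards [self_mem_nhdsWithin] with η hη
      have : 0 < η - 2 / 3 := sub_pos.2 hη
      exact mul_pos hC0 (by positivity)
  -- The ratio is at least the normalized Hardy power, with positive limit, times `1 / (C (η -
  -- 2/3)²)`.
  refine tendsto_atTop_mono' _ ?_ (tendsto_hardy_power.pos_mul_atTop hc hinv)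
  filter_upwards [eventually_optChshPower, tendsto_hardy_power.eventually (lt_mem_nhds hc)]
    with η ⟨ht, hpos, hle⟩ hH
  have hH' : 0 < hardy.power (effective η (hardyFamily η)) := by
    rw [div_pos_iff_of_pos_right (by positivity)] at hH
    exact hH
  rw [powerRatio]
  calc _ = hardy.power (effective η (hardyFamily η)) / (C * (η - 2 / 3) ^ 6) := by
        field_simp
    _ ≤ _ := by gcongr

end PostSel

theorem mainTheorem2 :
    (∀ η ∈ Ioc (2 / 3 : ℝ) 1,
      PostSel.IsHardyBehaviour (PostSel.hardyFamily η) ∧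
      BddAbove (PostSel.chshPowers η) ∧ 0 < PostSel.optChshPower η) ∧
    Tendsto
      (fun η : ℝ =>
        PostSel.hardy.power (PostSel.effective η (PostSel.hardyFamily η)) / (η - 2 / 3) ^ 4)
      (𝓝[>] (2 / 3)) (𝓝 ((2781 - 1215 * √5) / (4 * Real.log 2) / (Nat.factorial 4 : ℝ))) ∧
    PostSel.optChshPower =O[𝓝[>] (2 / 3)] (fun η : ℝ => (η - 2 / 3) ^ 6) ∧
    Tendsto (fun η : ℝ => PostSel.powerRatio η (PostSel.hardyFamily η))
      (𝓝[>] (2 / 3)) atTop := by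
  refine ⟨fun η hη => ⟨PostSel.isHardyBehaviour_hardyFamily hη,
    PostSel.bddAbove_chshPowers ⟨by linarith [hη.1], hη.2⟩, PostSel.optChshPower_pos hη⟩,
    PostSel.tendsto_hardy_power, ?_, PostSel.tendsto_powerRatio⟩
  refine IsBigO.of_bound (16 / 3 / Real.log 2 * 864 ^ 2) ?_
  filter_upwards [PostSel.eventually_optChshPower] with η ⟨ht, hpos, hle⟩
  rwa [Real.norm_of_nonneg hpos.le, Real.norm_of_nonneg (by positivity)]
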